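/- **Setting.** Let $S$ be a finite linearly ordered set. A potential on $X\subseteq S$ is a map from the power set of $X$ to the positive reals; it is identified with its name $\Lambda$, and $|\Lambda|:=|X|$. Let $\mathcal F$ be a finite family of potentials whose underlying sets cover $S$, and let $\mathcal J$ be a junction tree on $S$: a tree whose vertices are (or carry) subsets of $S$ that cover $S$ and have the running intersection property. Each factor $\Lambda\in\mathcal F$ is assigned to a vertex that contains its underlying set; $\mathcal F(C)$ is the set of factors assigned to $C$, and $H\sim C$ means that $H$ and $C$ are neighbours. A root, and an order in which the vertices are treated in each phase, are fixed (inward phase: children before parents; outward phase: parents before children). **ARCH-2.** Inward phase: every vertex $C$ other than the root sends its parent $P$ the message $M_{C\to P}$, the $(C\cap P)$-marginal of the product of the factors in $\mathcal F(C)$, of the constant potential $1$ on $C\cap P$ and of the messages from the children of $C$. Outward phase: every vertex $C$ computes, for each child $E$, the $(C\cap E)$-marginal of the product of the factors in $\mathcal F(C)$ and of all messages received by $C$, divides it by $M_{E\to C}$ and sends the quotient to $E$. In both phases, given potentials $\Upsilon_i$ on $D_1,\dots,D_k$ with $C=\bigcup_i D_i$ and with product $\Gamma$, all $D_i$-marginals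 of $\Gamma$ are computed simultaneously: the p-duals $Y\mapsto\prod_{Z\subseteq Y}\Upsilon_i(Z)^{(-1)^{|Z|}}$ are computed by recursion on the least element of $D_i$; they are multiplied, which gives the p-dual of $\Gamma$ on the down-closed family $\zeta=\bigcup_i\mathcal P(D_i)$ (it is $1$ elsewhere); by recursion on the least element of $C$ this is turned into the values on $\zeta$ of the m-dual $Y\mapsto\sum_{Y\subseteq Z\subseteq C}\Gamma(Z)$; its restriction to $\mathcal P(D_i)$ is the m-dual of the $D_i$-marginal, which is transformed back by recursion on the least element of $D_i$. A function on a down-closed family $\zeta$ of sets is stored in a straddle-tree: a full binary tree with labels in $S$ at its internal vertices, increasing downwards, whose leaves correspond to the members of $\zeta$ (the set of a leaf consists of the labels at which its branch turns right) and hold the values. All steps are performed by synchronised searches: given trees whose set of labels is $X$, one simulates, with a stack, the depth-first search of the complete straddle-tree of $\mathcal P(X)$, and an array indexed by $S$ holds for each label $e$ the vertices with label $e$ of the given trees that lie on the current branch, so that at the leaf for $Z\subseteq X$ exactly the leaves for $Z$ of the given trees are known. Arithmetic operations, memory accesses and the claiming or release of a memory cell take one unit of time. The factors are stored in advance. **Claim.**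 Put $w(m):=\max(1,m)\,2^m$. There is an absolute constant $K$ such that for all data as above: 1. The computation time $t(C)$ at each vertex $C$ (the time of its inward and its outward step) satisfies $$t(C)\le K\Bigl(w(|C|)+\sum_{H\text{ child of }C}w(|H\cap C|)+\sum_{\Lambda\in\mathcal F(C)}w(|\Lambda|)\Bigr).$$ 2. The total running time of the message passing equals $\sum_C t(C)$ and is at most $K\bigl(\sum_{C}w(|C|)+\sum_{\Lambda\in\mathcal F}w(|\Lambda|)\bigr)$. That is, each vertex $C$ contributes $O(|C|2^{|C|})$ (to the computation times at $C$ and at its parent only), and each factor $\Lambda$ contributes $O(|\Lambda|2^{|\Lambda|})$, where $|C|$ and $|\Lambda|$ as factors are read as $1$ for empty sets. 3. The number of memory cells in use never exceeds $$\sum_{\Lambda\in\mathcal F}2^{|\Lambda|+1}+\sum_{C}\sum_{H\sim C}2^{|C\cap H|+1}+2|S|+K\max_{C}\ \max(1,|C|)\Bigl(\sum_{H\sim C}2^{|H\cap C|}+\sum_{\Lambda\in\mathcal F(C)}2^{|\Lambda|}\Bigr).$$ The first two sums are the space for the factors and for all messages (a straddle-tree with $2^m$ leaves occupies $2^{m+1}$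 cells: $2^{m+1}-1$ vertices and a pointer); $2|S|$ is for two arrays indexed by $S$, and is at most of the order of the space for the factors. -/

import Mathlib

namespace ARCH2

/-! ### The inputs: junction trees, factors, and the way they are stored -/

/-- A junction tree on the finite set `S`: a tree whose vertices `C` carry subsets `bag C` of `S`
which cover `S` and have the running intersection property. -/
structure JunctionTree (S V : Type) where
  graph : SimpleGraph V
  isTree : graph.IsTree
  bag : V → Finset S
  cover : ∀ x : S, ∃ C, x ∈ bag C
  running : ∀ (C H : V) (p : graph.Walk C H), p.IsPath →
    ∀ x, x ∈ bag C → x ∈ bag H → ∀ D ∈ p.support, x ∈ bag D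

/-- A finite family of (strictly positive) potentials whose underlying sets cover `S`.
The number `value f Z` is meaningful for `Z ⊆ scope f`. -/
structure Factorisation (S F : Type) where
  scope : F → Finset S
  value : F → Finset S → ℝ
  pos : ∀ f, ∀ Z ⊆ scope f, 0 < value f Z
  cover : ∀ x : S, ∃ f, x ∈ scope f

/-- `H` is a child of `C` when the tree is rooted at `R`. -/
def JunctionTree.IsChild {S V : Type} (J : JunctionTree S V) (R C H : V) : Prop :=
  J.graph.Adj C H ∧ J.graph.dist R H = J.graph.dist R C + 1

/-- The choices made before the message passing starts: each factor is assigned to a vertex that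
contains its underlying set, a root is selected, and an order is fixed in which the vertices are
treated in the inward phase (children before parents) and in the outward phase (parents before
children). Children, parents and assigned factors are stored in lists. -/
structure Layout {S V F : Type} (J : JunctionTree S V) (Φ : Factorisation S F) where
  home : F → V
  scope_subset : ∀ f, Φ.scope f ⊆ J.bag (home f)
  root : V
  children : V → List V
  children_nodup : ∀ C, (children C).Nodup
  mem_children : ∀ C H, H ∈ children C ↔ J.IsChild root C H
  parent : V → Option V
  parent_eq : ∀ C P, parent C = some P ↔ J.IsChild root P C
  factors : V → List F
  factors_nodup : ∀ C, (factors C).Nodup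
  mem_factors : ∀ C f, f ∈ factors C ↔ home f = C
  allFactors : List F
  allFactors_nodup : allFactors.Nodup
  mem_allFactors : ∀ f, f ∈ allFactors
  inward : List V
  inward_nodup : inward.Nodup
  mem_inward : ∀ C, C ∈ inward
  inward_order : inward.Pairwise fun A B => ¬ J.IsChild root A B
  outward : List V
  outward_nodup : outward.Nodup
  mem_outward : ∀ C, C ∈ outward
  outward_order : outward.Pairwise fun A B => ¬ J.IsChild root B A

open Classical in
/-- The neighbourhood of a vertex of the junction tree. -/
noncomputable def JunctionTree.neighbours {S V : Type} [Fintype V] (J : JunctionTree S V)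
    (C : V) : Finset V :=
  Finset.univ.filter fun H => J.graph.Adj C H

/-! ### Straddle-trees and the machine

A straddle-tree is an oriented binary tree with labelled internal vertices. Its leaves are memory
addresses, at which the values `ψ(l)` of an info-tree are kept. A pointer to a vertex of a
straddle-tree is represented by the subtree below that vertex. -/

/-- Oriented binary trees with labels at the internal vertices and addresses at the leaves. -/
inductive Tree (S : Type) where
  | leaf (address : ℕ) : Tree S
  | node (label : S) (left right : Tree S) : Tree S

/-- The number of vertices. -/
def Tree.size {S : Type} : Tree S → ℕ
  | .leaf _ => 1
  | .node _ l r => l.size + r.size + 1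

/-- The number of internal vertices on the leftmost branch. In the straddle-tree of a straddle-set
`ζ` this is the cardinality of the union of `ζ`. -/
def Tree.spine {S : Type} : Tree S → ℕ
  | .leaf _ => 0
  | .node _ l _ => l.spine + 1

/-- The state of the machine. `time` counts elementary operations, `live` is the number of memory
cells (of constantly many words) in use, and `peak` is the largest value that `live` has had.
Members of `array e` and of `found` carry a number which tells to which of the searched trees they
belong. -/
structure Machine (S R : Type) where
  /-- the values stored at the leaves -/
  value : ℕ → R
  /-- the first address not yet handed out -/
  next : ℕ
  /-- the array `𝒜`: for each label a set of internal vertices -/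
  array : S → List (ℕ × Tree S)
  /-- the set `ℒ` of leaves -/
  found : List (ℕ × ℕ)
  /-- a Boolean array, used to find the labels that occur in given trees -/
  mark : S → Bool
  time : ℕ
  live : ℕ
  peak : ℕ

/-- Programs: state transformers of the machine that return a value. -/
abbrev Prog (S R α : Type) := StateM (Machine S R) α

section Programs

variable {S R : Type}

/-! #### Elementary operations -/

/-- `n` elementary operations. -/
def spend (n : ℕ) : Prog S R Unit :=
  modify fun s => { s with time := s.time + n }

/-- Claim `n` memory cells, in time `n`. -/
def alloc (n : ℕ) : Prog S R Unit :=
  modify fun s => { s with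
    time := s.time + n, live := s.live + n, peak := max s.peak (s.live + n) }

/-- Give `n` memory cells back, in time `n`. -/
def free (n : ℕ) : Prog S R Unit :=
  modify fun s => { s with time := s.time + n, live := s.live - n }

/-- Run a recursive procedure, which occupies a cell of the recursion stack meanwhile. -/
def call {α : Type} (p : Prog S R α) : Prog S R α := do
  alloc 1
  let a ← p
  free 1
  return a

/-- Read the value of a leaf. -/
def readLeaf (a : ℕ) : Prog S R R := do
  spend 1
  let s ← get
  return s.value a

/-- Overwrite the value of a leaf. -/
def writeLeaf (a : ℕ) (v : R) : Prog S R Unit := do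
  spend 1
  modify fun s => { s with value := Function.update s.value a v }

/-- Create a leaf with value `v`. -/
def newLeaf (v : R) : Prog S R (Tree S) := do
  alloc 1
  let s ← get
  set { s with value := Function.update s.value s.next v, next := s.next + 1 }
  return .leaf s.next

/-- Create an internal vertex. -/
def newNode (x : S) (l r : Tree S) : Prog S R (Tree S) := do
  alloc 1
  return .node x l r

/-- Do `f` for each member of a list, one after the other. -/
def forEach {α : Type} (f : α → Prog S R Unit) : List α → Prog S R Unit
  | [] => spend 1
  | a :: l => do
    spend 1
    f a
    forEach f l

/-- Do `f` for each member of a list, one after the other, and list the results. -/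
def mapEach {α β : Type} (f : α → Prog S R β) : List α → Prog S R (List β)
  | [] => do
    spend 1
    return []
  | a :: l => do
    spend 1
    let b ← f a
    let bs ← mapEach f l
    return b :: bs

/-! #### Copying, creating and deleting trees

A stored tree occupies one cell for each of its vertices and one for the pointer to its root. -/

/-- Copy all vertices of a tree, with the values at the leaves. -/
def copyVertices : Tree S → Prog S R (Tree S)
  | .leaf a => do
    let v ← readLeaf a
    newLeaf v
  | .node x l r => call do
    let l' ← copyVertices l
    let r' ← copyVertices r
    newNode x l' r'

/-- Copy a tree. -/
def copyTree (t : Tree S) : Prog S R (Tree S) := do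
  alloc 1
  copyVertices t

/-- Delete a tree. -/
def dispose (t : Tree S) : Prog S R Unit :=
  free (t.size + 1)

/-- Create the vertices of the info-tree of the potential `Z ↦ g Z` on the set with the increasing
enumeration `D`. The left subtree of a vertex labelled `x` is for the sets without `x`, the right
subtree for the sets with `x`. -/
def newVertices [DecidableEq S] : List S → (Finset S → R) → Prog S R (Tree S)
  | [], g => newLeaf (g ∅)
  | x :: D, g => call do
    let l ← newVertices D g
    let r ← newVertices D (fun Z => g (insert x Z))
    newNode x l r

/-- Create the info-tree of a potential. -/
def newTree [LinearOrder S] (D : Finset S) (g : Finset S → R) : Prog S R (Tree S) := do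
  alloc 1
  newVertices (D.sort (· ≤ ·)) g

/-! #### The set `X` of labels of a synchronised search -/

/-- Add the labels of a tree that are not yet marked to the list `acc`, and mark them. -/
def collect [DecidableEq S] : Tree S → List S → Prog S R (List S)
  | .leaf _, acc => do
    spend 1
    return acc
  | .node x l r, acc => call do
    spend 1
    let s ← get
    if s.mark x then
      let acc' ← collect l acc
      collect r acc'
    else
      alloc 1
      set { (← get) with mark := Function.update s.mark x true }
      let acc' ← collect l (x :: acc)
      collect r acc'

/-- Collect the labels of several trees. -/
def collectAll [DecidableEq S] : List (ℕ × Tree S) → List S → Prog S R (List S)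
  | [], acc => do
    spend 1
    return acc
  | (_, t) :: ts, acc => do
    spend 1
    let acc' ← collect t acc
    collectAll ts acc'

/-- Remove the mark of a label. -/
def unmark [DecidableEq S] (x : S) : Prog S R Unit := do
  spend 1
  modify fun s => { s with mark := Function.update s.mark x false }

/-- Insert a label into an increasing list. -/
def insertLabel [LinearOrder S] (x : S) : List S → Prog S R (List S)
  | [] => do
    spend 1
    return [x]
  | y :: l => do
    spend 1
    if x ≤ y then
      return x :: y :: l
    else
      let l' ← insertLabel x l
      return y :: l'

/-- Sort a list of labels by insertion. -/
def sortLabels [LinearOrder S] : List S → List S → Prog S R (List S)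
  | [], sorted => do
    spend 1
    return sorted
  | x :: l, sorted => do
    spend 1
    let sorted' ← insertLabel x sorted
    sortLabels l sorted'

/-- Find the increasing list `X` of all labels of the given trees; it occupies a cell for each
label. -/
def labels [LinearOrder S] (ts : List (ℕ × Tree S)) : Prog S R (List S) := do
  let l ← collectAll ts []
  forEach unmark l
  sortLabels l []

/-! #### Synchronised searches -/

/-- Add a vertex to the set `ℒ` if it is a leaf, and else to the set `𝒜(e)`, where `e` is its
label. -/
def place [DecidableEq S] : ℕ × Tree S → Prog S R Unit
  | (i, .leaf a) => do
    alloc 1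
    modify fun s => { s with found := (i, a) :: s.found }
  | (i, .node x l r) => do
    alloc 1
    modify fun s => { s with array := Function.update s.array x ((i, .node x l r) :: s.array x) }

/-- Place the left child of a vertex. -/
def placeLeft [DecidableEq S] : ℕ × Tree S → Prog S R Unit
  | (_, .leaf _) => spend 1
  | (i, .node _ l _) => place (i, l)

/-- Place the right child of a vertex. -/
def placeRight [DecidableEq S] : ℕ × Tree S → Prog S R Unit
  | (_, .leaf _) => spend 1
  | (i, .node _ _ r) => place (i, r)

/-- Set `𝒜(e) ← ∅`. -/
def clearArray [DecidableEq S] (e : S) : Prog S R Unit := do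
  spend 1
  let s ← get
  free (s.array e).length
  modify fun s => { s with array := Function.update s.array e [] }

/-- Set `ℒ ← ∅`. -/
def clearFound : Prog S R Unit := do
  spend 1
  let s ← get
  free s.found.length
  modify fun s => { s with found := [] }

/-- The ghost-search of the set with the increasing enumeration `X`, with the operations on `𝒜` and
`ℒ` of a synchronised search. It is written recursively, so that the stack of the ghost-search is
the recursion stack. The first, second and third encounter with `e` are the three time-steps at
which `(e,1)`, `(e,2)`, `(e,3)` is on top of the stack. At every leaf-step `leafStep ℒ` is run. If
the search builds something, `join` is run at the third encounter with `e`, and is told whether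
`𝒜(e)` is non-empty and what has been built between the encounters. -/
def search [DecidableEq S] {α : Type} (leafStep : List (ℕ × ℕ) → Prog S R α)
    (join : S → Bool → α → α → Prog S R α) : List S → Prog S R α
  | [] => do
    spend 1
    let s ← get
    let a ← leafStep s.found
    clearFound
    return a
  | e :: X => call do
    spend 1
    let s ← get
    forEach placeLeft (s.array e)
    let a ← search leafStep join X
    spend 1
    let s ← get
    forEach placeRight (s.array e)
    let b ← search leafStep join X
    spend 1
    let s ← get
    let c ← join e (!(s.array e).isEmpty) a b
    clearArray e
    return c

/-- The synchronised search of a list of (numbered) trees. -/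
def synchronisedSearch [LinearOrder S] {α : Type} (leafStep : List (ℕ × ℕ) → Prog S R α)
    (join : S → Bool → α → α → Prog S R α) (ts : List (ℕ × Tree S)) : Prog S R α := do
  let X ← labels ts
  forEach place ts
  let a ← search leafStep join X
  free X.length
  return a

/-- A synchronised search that only acts at leaf-steps. -/
def visitLeaves [LinearOrder S] (leafStep : List (ℕ × ℕ) → Prog S R Unit)
    (ts : List (ℕ × Tree S)) : Prog S R Unit :=
  synchronisedSearch leafStep (fun _ _ _ _ => pure ()) ts

/-! #### The recursive transformations -/

/-- If `ℒ` contains a leaf `l₀` of tree 0, set `ψ(l₀) ← f ψ(l₁) ψ(l₂)`, where `l₁` is the leaf of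
tree 1 in `ℒ`, and `l₂` the leaf of tree 2, if there is one. -/
def assignLeaf (f : R → Option R → R) (L : List (ℕ × ℕ)) : Prog S R Unit := do
  spend L.length
  match L.lookup 0, L.lookup 1, L.lookup 2 with
  | some a₀, some a₁, some a₂ => do
    let v₁ ← readLeaf a₁
    let v₂ ← readLeaf a₂
    spend 1
    writeLeaf a₀ (f v₁ (some v₂))
  | some a₀, some a₁, none => do
    let v₁ ← readLeaf a₁
    spend 1
    writeLeaf a₀ (f v₁ none)
  | _, _, _ => pure ()

/-- For every leaf `l₀` of `t₀` set `ψ(l₀) ← f ψ(l₁) ψ(l₂)`, where `l₁` and `l₂` are the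
corresponding leaves of `t₁` and `t₂`. -/
def assignTree [LinearOrder S] (f : R → Option R → R) (t₀ t₁ t₂ : Tree S) : Prog S R Unit :=
  visitLeaves (assignLeaf f) [(0, t₀), (1, t₁), (2, t₂)]

/-- The arithmetic of a recursive transformation `Φ ↦ Φ'`. With `x` the least element of the
underlying set and `Y ∌ x`, the values of `Φ₋` and `Φ₊` at `Y` are computed from those of `Φ` at `Y`
and `Y ∪ {x}` (the latter may be absent), and the values of `Φ'` at `Y` and `Y ∪ {x}` from those of
`Φ₋'` and `Φ₊'` at `Y`. -/
structure Rule (R : Type) where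
  splitMinus : R → Option R → R
  splitPlus : R → Option R → R
  joinMinus : R → Option R → R
  joinPlus : R → Option R → R

/-- From a potential to its p-dual. -/
def rule1 [Field R] : Rule R where
  splitMinus a _ := a
  splitPlus a b := b.getD a
  joinMinus a _ := a
  joinPlus a b := b.elim a fun c => a / c

/-- From the p-dual of a potential (in sparse format) to its m-dual. -/
def rule2 [Field R] : Rule R where
  splitMinus a _ := a
  splitPlus a b := b.elim a fun c => a / c
  joinMinus a b := b.elim a fun c => a + c
  joinPlus a b := b.getD a

/-- From the m-dual of a potential to the potential. -/
def rule3 [Field R] : Rule R where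
  splitMinus a b := b.elim a fun c => a - c
  splitPlus a b := b.getD a
  joinMinus a _ := a
  joinPlus a b := b.getD a

/-- The recursion shared by **transform1**, **transform2** and **transform3**, on info-trees. The
tree it returns is new. It ends at the empty underlying set, that is at a tree which is a leaf; the
number, a bound of the depth of the recursion, only serves to make the recursion well-founded. -/
def transformAux [LinearOrder S] (ρ : Rule R) : ℕ → Tree S → Prog S R (Tree S)
  | _, .leaf a => copyTree (.leaf a)
  | 0, .node x l r => copyTree (.node x l r)
  | k + 1, .node x l r => call do
    let minus ← copyTree l
    let plus ← copyTree l
    assignTree ρ.splitMinus minus l r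
    assignTree ρ.splitPlus plus l r
    let minus' ← transformAux ρ k minus
    dispose minus
    let plus' ← transformAux ρ k plus
    dispose plus
    let t ← copyTree (.node x l r)
    match t with
    | .leaf _ => pure ()
    | .node _ l' r' => do
      assignTree ρ.joinMinus l' minus' plus'
      assignTree ρ.joinPlus r' minus' plus'
    dispose minus'
    dispose plus'
    return t

/-- The recursive transformation of an info-tree. -/
def transform [LinearOrder S] (ρ : Rule R) (t : Tree S) : Prog S R (Tree S) :=
  transformAux ρ t.spine t

/-! #### The functions **product** and **marginalise** -/

/-- Multiply the values of those members of a list of leaves that do not belong to tree 0. -/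
def multiplyValues [Field R] : List (ℕ × ℕ) → R → Prog S R R
  | [], v => do
    spend 1
    return v
  | (i, a) :: L, v => do
    spend 1
    if i = 0 then
      multiplyValues L v
    else
      let w ← readLeaf a
      multiplyValues L (v * w)

/-- If `ℒ` contains a leaf of tree 0, give it the product of the values of the other leaves. -/
def multiplyLeaf [Field R] (L : List (ℕ × ℕ)) : Prog S R Unit := do
  spend L.length
  match L.lookup 0 with
  | some a => do
    let v ← multiplyValues L 1
    writeLeaf a v
  | none => pure ()

/-- If `ℒ` contains a leaf of tree 0, give its value to the other leaves in `ℒ`. -/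
def spreadLeaf (L : List (ℕ × ℕ)) : Prog S R Unit := do
  spend L.length
  match L.lookup 0 with
  | some a => do
    let v ← readLeaf a
    forEach (fun l : ℕ × ℕ => if l.1 = 0 then spend 1 else writeLeaf l.2 v) L
  | none => pure ()

/-- The leaf-step of the construction of the straddle-tree of a union: a leaf is added if some
tree has one. -/
def unionLeaf [Field R] (L : List (ℕ × ℕ)) : Prog S R (Option (Tree S)) := do
  spend 1
  if L.isEmpty then
    return none
  else
    let t ← newLeaf 1
    return some t

/-- The internal vertices in the construction of the straddle-tree of a union: there is a vertex
with label `e` if `𝒜(e)` is non-empty. -/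
def unionNode (e : S) (present : Bool) (a b : Option (Tree S)) : Prog S R (Option (Tree S)) := do
  spend 1
  match present, a, b with
  | true, some l, some r => do
    let t ← newNode e l r
    return some t
  | _, _, _ => return a

/-- Number the trees other than tree 0. -/
def others (ts : List (Tree S)) : List (ℕ × Tree S) := ts.map fun t => (1, t)

/-- The function **product**: from the p-duals of potentials on `D₁, …, D_k` to the p-dual of their
product, in sparse format on the union of the power sets of the `Dᵢ`. -/
def product [LinearOrder S] [Field R] (ts : List (Tree S)) : Prog S R (Tree S) := do
  alloc 1
  let u ← synchronisedSearch unionLeaf unionNode (others ts)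
  match u with
  | none => newLeaf 1
  | some t => do
    visitLeaves multiplyLeaf ((0, t) :: others ts)
    return t

/-- The function **marginalise**: from the m-dual `t` of a potential (in sparse format) to the
m-duals of its marginals. The marginals are stored in copies of the trees `ts`. -/
def marginalise [LinearOrder S] (t : Tree S) (ts : List (Tree S)) :
    Prog S R (List (Tree S)) := do
  let us ← mapEach copyTree ts
  visitLeaves spreadLeaf ((0, t) :: others us)
  return us

/-- From potentials `Υᵢ` on sets `Dᵢ` to the `Dᵢ`-marginals of their product. -/
def marginals [LinearOrder S] [Field R] (ts : List (Tree S)) : Prog S R (List (Tree S)) := do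
  let ps ← mapEach (transform rule1) ts
  let g ← product ps
  forEach dispose ps
  let h ← transform rule2 g
  dispose g
  let ms ← marginalise h ts
  dispose h
  let us ← mapEach (transform rule3) ms
  forEach dispose ms
  return us

end Programs

/-! ### The message passing -/

/-- `msg C E` points to the stored message from `C` to `E` (once it has been sent), and `clock C`
is the computation time at `C` so far. -/
structure Store (S V : Type) where
  msg : V → V → Tree S
  clock : V → ℕ

section Messages

variable {S V R : Type}

/-- Store the message from `C` to `E`. -/
def send [DecidableEq V] (C E : V) (t : Tree S) (σ : Store S V) : Store S V :=
  { σ with msg := Function.update σ.msg C (Function.update (σ.msg C) E t) }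

/-- Inward phase: `C` sends a message to its parent. Here `fs` are the factors assigned to `C`. The
sorted set `C ∩ parent C` is stored with the junction tree. -/
def inwardStep [LinearOrder S] [DecidableEq V] [Field R] (bag : V → Finset S)
    (children : V → List V) (parent : V → Option V) (fs : List (Tree S)) (C : V)
    (σ : Store S V) : Prog S R (Store S V) := do
  spend 1
  match parent C with
  | none => return σ
  | some P => do
    let one ← newTree (bag C ∩ bag P) (fun _ => 1)
    let inputs := one :: ((children C).map (fun H => σ.msg H C) ++ fs)
    alloc inputs.length
    let outputs ← marginals inputs
    free inputs.length
    dispose one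
    match outputs with
    | [] => return σ
    | t :: rest => do
      forEach dispose rest
      spend 1
      return send C P t σ

/-- Divide the potentials computed at `C` for its children by the messages received from them, and
send the quotients. Superfluous potentials are deleted. -/
def divideAndSend [LinearOrder S] [DecidableEq V] [Field R] (C : V) :
    List V → List (Tree S) → Store S V → Prog S R (Store S V)
  | E :: Es, t :: ts, σ => do
    spend 1
    assignTree (fun a b => b.elim a fun c => a / c) t t (σ.msg E C)
    divideAndSend C Es ts (send C E t σ)
  | _, ts, σ => do
    forEach dispose ts
    return σ

/-- Outward phase: `C` sends messages to all its children. -/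
def outwardStep [LinearOrder S] [DecidableEq V] [Field R]
    (children : V → List V) (parent : V → Option V) (fs : List (Tree S)) (C : V)
    (σ : Store S V) : Prog S R (Store S V) := do
  spend 1
  if (children C).isEmpty then
    return σ
  else
    let inputs := (children C).map (fun H => σ.msg H C) ++
      ((parent C).toList.map (fun P => σ.msg P C) ++ fs)
    alloc inputs.length
    let outputs ← marginals inputs
    free inputs.length
    divideAndSend C (children C) outputs σ

/-- Perform a step at each vertex of a list, and add its duration to the computation time at the
vertex. -/
def phase [DecidableEq V] (step : V → Store S V → Prog S R (Store S V)) :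
    List V → Store S V → Prog S R (Store S V)
  | [], σ => return σ
  | C :: Cs, σ => do
    let start ← get
    spend 1
    let σ' ← step C σ
    let finish ← get
    phase step Cs { σ' with
      clock := Function.update σ'.clock C (σ'.clock C + (finish.time - start.time)) }

/-- Store the factors of a list as info-trees. -/
def loadFactors {F : Type} [LinearOrder S] [DecidableEq F] (scope : F → Finset S)
    (value : F → Finset S → R) :
    List F → (F → Tree S) → Prog S R (F → Tree S)
  | [], stored => return stored
  | f :: fs, stored => do
    let t ← newTree (scope f) (value f)
    loadFactors scope value fs (Function.update stored f t)

/-- An empty memory, except for the two arrays of size `|S|`. -/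
def emptyMachine (S R : Type) [Fintype S] [Zero R] : Machine S R where
  value := fun _ => 0
  next := 0
  array := fun _ => []
  found := []
  mark := fun _ => false
  time := 0
  live := 2 * Fintype.card S
  peak := 2 * Fintype.card S

/-- The message passing of ARCH-2. The factors are part of the input: they are in the memory when
the counting of time and of the maximal number of used cells starts. -/
def messagePassing {F : Type} [Fintype S] [LinearOrder S] [DecidableEq V] [DecidableEq F] [Field R]
    (bag : V → Finset S) (scope : F → Finset S) (value : F → Finset S → R)
    (children : V → List V) (parent : V → Option V) (factors : V → List F) (allFactors : List F)
    (inward outward : List V) : Store S V × Machine S R :=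
  let input := (loadFactors scope value allFactors fun _ => .leaf 0).run (emptyMachine S R)
  let start : Machine S R := { input.2 with time := 0, peak := input.2.live }
  let fs : V → List (Tree S) := fun C => (factors C).map input.1
  let program : Prog S R (Store S V) := do
    let σ ← phase (fun C => inwardStep bag children parent (fs C) C) inward
      { msg := fun _ _ => .leaf 0, clock := fun _ => 0 }
    phase (fun C => outwardStep children parent (fs C) C) outward σ
  program.run start

end Messages

/-- ARCH-2 on a junction tree, a family of factors and a layout of these. -/
noncomputable def arch2 {S V F : Type} [Fintype S] [LinearOrder S] [DecidableEq V] [DecidableEq F]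
    (J : JunctionTree S V) (Φ : Factorisation S F) (L : Layout J Φ) : Store S V × Machine S ℝ :=
  messagePassing J.bag Φ.scope Φ.value L.children L.parent L.factors L.allFactors
    L.inward L.outward

/-- `m 2 ^ m`, with the value 1 at `m = 0`. -/
def weight (m : ℕ) : ℕ := max 1 m * 2 ^ m

end ARCH2

/-!
Neither the course of the message passing nor its costs depend on the values of the potentials: both
are determined by the shapes of the straddle-trees involved. Of these shapes the analysis only needs
that labels increase downwards and that the labels to the right of a vertex also occur to its left
(`Tree.Good`), so that the number of labels is the length of the leftmost branch and a tree with `m`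
labels has fewer than `2 ^ (m + 1)` vertices.

Costs are tracked by a Hoare logic. A triple `Triple p c n τ π Q` bounds the time of the program `p`
by `τ` and the number of cells it ever owns by `π`, and describes the number of cells it owns in the
end exactly. Cells not owned by `p` form a frame, as in separation logic, so that triples compose.

The central estimate is `triple_search`. At any time of a ghost-search of `X`, the vertices of the
given trees that are still to be met are those below the vertices in the sets `𝒜(e)`, `e ∈ X`, and
`ℒ` (`Config.pending`). Each of them is placed once, while each of the `O(2 ^ |X|)` steps of the
ghost-search itself has a constant cost. Hence the search takes time `O(2 ^ |X| + s)` and memory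
`O(|X| + s)`, where `s` is the total number of vertices of the trees, however many trees there are.

A recursive transformation of a tree with `m` labels and `s` vertices makes two recursive calls for
trees with `m - 1` labels, the second one after the temporary memory of the first has been
released. So it takes time `O((m + 1) 2 ^ m)` and memory `O((m + 1) s)` (`triple_transformAux`). The
straddle-tree of a union is not larger than the given trees together (`IsUnion`), which yields the
costs of the simultaneous marginalisation (`triple_marginals`).

In the message passing, the orders of the two phases guarantee that all messages needed at a vertex
have been sent, so that each of them is the complete tree on the intersection of two neighbouring
bags (`Layout.InwardInv`, `Layout.OutwardInv`). Adding up over the vertices (`phase_costs`) uses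
that the parent and the children of a vertex are distinct neighbours, for the memory, and that every
vertex has at most one parent, for the time.
-/

namespace ARCH2

/-! ### A cost logic for the machine -/

section Triples

variable {S R α β : Type}

/-- The part of the memory of a machine on which the course of a program depends, apart from the
shapes of the trees that it is given: the array `𝒜`, the set `ℒ` and the marks. -/
structure Config (S : Type) where
  array : S → List (ℕ × Tree S)
  found : List (ℕ × ℕ)
  mark : S → Bool

/-- The configuration of a machine. -/
def Machine.config (s : Machine S R) : Config S := ⟨s.array, s.found, s.mark⟩

/-- `Triple p c n τ π Q`: started in the configuration `c`, and owning `n` of the memory cells in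
use, the program `p` takes time at most `τ`, never owns more than `π` cells, and ends with a result
`a`, a configuration `c'` and a number `m` of owned cells such that `Q a c' m`. The cells that it
does not own (`b` of them) stay in use, so that the truncated subtraction in `free` is harmless. -/
def Triple (p : Prog S R α) (c : Config S) (n τ π : ℕ) (Q : α → Config S → ℕ → Prop) : Prop :=
  ∀ (s : Machine S R) (b : ℕ), s.config = c → s.live = b + n →
    ∃ m, Q (p.run s).1 (p.run s).2.config m ∧ (p.run s).2.live = b + m ∧
      s.time ≤ (p.run s).2.time ∧ (p.run s).2.time ≤ s.time + τ ∧
      (p.run s).2.peak ≤ max s.peak (b + π)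

variable {p : Prog S R α} {c : Config S} {n τ π : ℕ} {Q : α → Config S → ℕ → Prop}

/-- Sequential composition, where `k` of the cells owned are not needed by the first program; the
second one runs on the remaining budget of time. -/
theorem Triple.bind {f : α → Prog S R β} {Q' : β → Config S → ℕ → Prop} (k : ℕ) {n₁ τ₁ π₁ : ℕ}
    (h : Triple p c n₁ τ₁ π₁ Q) (hn : n = n₁ + k) (hτ : τ₁ ≤ τ) (hπ : π₁ + k ≤ π)
    (hf : ∀ a c' m, Q a c' m → Triple (f a) c' (m + k) (τ - τ₁) π Q') :
    Triple (p >>= f) c n τ π Q' := by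
  intro s b hc hl
  obtain ⟨m, hQ, hl', ht, ht', hp⟩ := h s (b + k) hc (by omega)
  obtain ⟨m', hQ', hl'', hu, hu', hp'⟩ := hf _ _ _ hQ (p.run s).2 b rfl (by omega)
  refine ⟨m', hQ', hl'', ht.trans hu, ?_, ?_⟩
  · change ((f (p.run s).1).run (p.run s).2).2.time ≤ _
    omega
  · change ((f (p.run s).1).run (p.run s).2).2.peak ≤ _
    omega

theorem Triple.conseq {Q' : α → Config S → ℕ → Prop} (k : ℕ) {n₁ τ₁ π₁ : ℕ}
    (h : Triple p c n₁ τ₁ π₁ Q) (hn : n = n₁ + k) (hτ : τ₁ ≤ τ) (hπ : π₁ + k ≤ π)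
    (hQ : ∀ a c' m, Q a c' m → Q' a c' (m + k)) : Triple p c n τ π Q' := by
  intro s b hc hl
  obtain ⟨m, hm, hl', ht, ht', hp⟩ := h s (b + k) hc (by omega)
  exact ⟨m + k, hQ _ _ _ hm, by omega, ht, by omega, by omega⟩

theorem Triple.pure {a : α} (h : Q a c n) : Triple (R := R) (Pure.pure a) c n τ π Q := by
  intro s b hc hl
  exact ⟨n, hc ▸ h, hl, le_rfl, Nat.le_add_right _ _, le_max_left _ _⟩

theorem Triple.get {f : Machine S R → Prog S R α}
    (h : ∀ s : Machine S R, s.config = c → Triple (f s) c n τ π Q) :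
    Triple (MonadState.get >>= f) c n τ π Q :=
  fun s b hc hl => h s hc s b hc hl

theorem Triple.get_set {g : Machine S R → Machine S R} {f : PUnit → Prog S R α}
    (h : Triple (modify g >>= f) c n τ π Q) :
    Triple (MonadState.get >>= fun s => MonadStateOf.set (g s) >>= f) c n τ π Q :=
  h

theorem triple_modify {c' : Config S} {g : Machine S R → Machine S R}
    (hc : ∀ s, s.config = c → (g s).config = c') (hl : ∀ s, (g s).live = s.live)
    (ht : ∀ s, (g s).time = s.time) (hp : ∀ s, (g s).peak = s.peak) :
    Triple (R := R) (modify g) c 0 0 0 (fun _ d m => d = c' ∧ m = 0) := by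
  intro s b h h'
  refine ⟨0, ⟨hc s h, rfl⟩, (hl s).trans h', (ht s).ge, (ht s).le, ?_⟩
  exact (hp s).trans_le (le_max_left _ _)

theorem triple_spend (k : ℕ) :
    Triple (R := R) (spend k) c 0 k 0 (fun _ c' m => c' = c ∧ m = 0) := by
  intro s b hc hl
  exact ⟨0, ⟨hc, rfl⟩, hl, Nat.le_add_right _ _, le_rfl, le_max_left _ _⟩

theorem triple_alloc (k : ℕ) :
    Triple (R := R) (alloc k) c 0 k k (fun _ c' m => c' = c ∧ m = k) := by
  intro s b hc hl
  refine ⟨k, ⟨hc, rfl⟩, ?_, Nat.le_add_right _ _, le_rfl, ?_⟩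
  · change s.live + k = _
    omega
  · change max s.peak (s.live + k) ≤ _
    omega

theorem triple_free (k : ℕ) :
    Triple (R := R) (free k) c k k k (fun _ c' m => c' = c ∧ m = 0) := by
  intro s b hc hl
  refine ⟨0, ⟨hc, rfl⟩, ?_, Nat.le_add_right _ _, le_rfl, le_max_left _ _⟩
  change s.live - k = _
  omega

theorem Triple.call {τ₁ π₁ : ℕ} (h : Triple p c n τ₁ π₁ Q) (hn : n + 1 ≤ π) (hτ : τ₁ + 2 ≤ τ)
    (hπ : π₁ + 1 ≤ π) : Triple (call p) c n τ π Q := by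
  refine Triple.bind n (triple_alloc 1) (by omega) (by omega) (by omega) ?_
  rintro _ _ _ ⟨rfl, rfl⟩
  refine Triple.bind 1 h (by omega) (by omega) (by omega) ?_
  intro a c' m hQ s b hc hl
  refine ⟨m, ?_, ?_, ?_, ?_, le_max_left _ _⟩
  · exact hc ▸ hQ
  · change s.live - 1 = _
    omega
  · exact Nat.le_add_right _ _
  · change s.time + 1 ≤ _
    omega

theorem triple_readLeaf (a : ℕ) :
    Triple (R := R) (readLeaf a) c 0 1 0 (fun _ c' m => c' = c ∧ m = 0) := by
  intro s b hc hl
  exact ⟨0, ⟨hc, rfl⟩, hl, Nat.le_add_right _ _, le_rfl, le_max_left _ _⟩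

theorem triple_writeLeaf (a : ℕ) (v : R) :
    Triple (writeLeaf a v) c 0 1 0 (fun _ c' m => c' = c ∧ m = 0) := by
  intro s b hc hl
  exact ⟨0, ⟨hc, rfl⟩, hl, Nat.le_add_right _ _, le_rfl, le_max_left _ _⟩

theorem triple_newLeaf (v : R) :
    Triple (newLeaf v) c 0 1 1 (fun t c' m => (∃ a, t = Tree.leaf a) ∧ c' = c ∧ m = 1) := by
  intro s b hc hl
  refine ⟨1, ⟨⟨_, rfl⟩, hc, rfl⟩, ?_, Nat.le_add_right _ _, le_rfl, ?_⟩
  · change s.live + 1 = _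
    omega
  · change max s.peak (s.live + 1) ≤ _
    omega

theorem triple_newNode (x : S) (l r : Tree S) :
    Triple (R := R) (newNode x l r) c 0 1 1
      (fun t c' m => t = Tree.node x l r ∧ c' = c ∧ m = 1) := by
  intro s b hc hl
  refine ⟨1, ⟨rfl, hc, rfl⟩, ?_, Nat.le_add_right _ _, le_rfl, ?_⟩
  · change s.live + 1 = _
    omega
  · change max s.peak (s.live + 1) ≤ _
    omega

theorem triple_forEach {f : α → Prog S R Unit} {l : List α} {ν τ₁ : α → ℕ} {B : ℕ}
    (h : ∀ a ∈ l, Triple (f a) c (ν a) (τ₁ a) (ν a + B) (fun _ c' m => c' = c ∧ m = 0)) :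
    Triple (forEach f l) c (l.map ν).sum ((l.map τ₁).sum + l.length + 1) ((l.map ν).sum + B)
      (fun _ c' m => c' = c ∧ m = 0) := by
  induction l with
  | nil =>
    exact Triple.conseq 0 (triple_spend 1) rfl (by simp) (by simp) (fun _ _ _ h => h)
  | cons a l ih =>
    have hh := ih fun a ha => h a (List.mem_cons_of_mem _ ha)
    simp only [List.map_cons, List.sum_cons, List.length_cons]
    refine Triple.bind (ν a + (l.map ν).sum) (triple_spend 1) (by omega) (by omega) (by omega) ?_
    rintro _ _ _ ⟨rfl, rfl⟩
    refine Triple.bind (l.map ν).sum (h a List.mem_cons_self) (by omega) (by omega) (by omega) ?_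
    rintro _ _ _ ⟨rfl, rfl⟩
    exact Triple.conseq 0 hh (by omega) (by omega) (by omega) (fun _ _ _ h => h)

theorem triple_mapEach {f : α → Prog S R β} {l : List α} {g τ₁ : α → ℕ} {B : ℕ}
    {r : α → β → Prop}
    (h : ∀ a ∈ l, Triple (f a) c 0 (τ₁ a) B (fun t c' m => r a t ∧ c' = c ∧ m = g a)) :
    Triple (mapEach f l) c 0 ((l.map τ₁).sum + l.length + 1) ((l.map g).sum + B)
      (fun ts c' m => List.Forall₂ r l ts ∧ c' = c ∧ m = (l.map g).sum) := by
  induction l with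
  | nil =>
    refine Triple.bind 0 (triple_spend 1) rfl (by simp) (by simp) ?_
    rintro _ _ _ ⟨rfl, rfl⟩
    exact Triple.pure ⟨List.Forall₂.nil, rfl, rfl⟩
  | cons a l ih =>
    have hh := ih fun a ha => h a (List.mem_cons_of_mem _ ha)
    simp only [List.map_cons, List.sum_cons, List.length_cons]
    refine Triple.bind 0 (triple_spend 1) (by omega) (by omega) (by omega) ?_
    rintro _ _ _ ⟨rfl, rfl⟩
    refine Triple.bind 0 (h a List.mem_cons_self) (by omega) (by omega) (by omega) ?_
    rintro b _ _ ⟨hb, rfl, rfl⟩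
    refine Triple.bind (g a) hh (by omega) (by omega) (by omega) ?_
    rintro bs _ _ ⟨hbs, rfl, rfl⟩
    exact Triple.pure ⟨List.Forall₂.cons hb hbs, rfl, by omega⟩

end Triples

/-! ### Shapes of straddle-trees -/

section Shapes

variable {S : Type}

/-- The shape of a tree: the addresses at the leaves are forgotten. -/
def Tree.shape : Tree S → Tree S
  | .leaf _ => .leaf 0
  | .node x l r => .node x l.shape r.shape

theorem Tree.size_shape (t : Tree S) : t.shape.size = t.size := by
  induction t with
  | leaf a => rfl
  | node x l r ihl ihr => simp [Tree.shape, Tree.size, ihl, ihr]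

theorem Tree.size_eq_of_shape_eq {t u : Tree S} (h : t.shape = u.shape) : t.size = u.size := by
  rw [← t.size_shape, h, u.size_shape]

theorem Tree.one_le_size (t : Tree S) : 1 ≤ t.size := by
  cases t <;> simp [Tree.size]

variable [DecidableEq S]

/-- The set of labels of a tree. -/
def Tree.lab : Tree S → Finset S
  | .leaf _ => ∅
  | .node x l r => insert x (l.lab ∪ r.lab)

theorem Tree.lab_shape (t : Tree S) : t.shape.lab = t.lab := by
  induction t with
  | leaf a => rfl
  | node x l r ihl ihr => simp [Tree.shape, Tree.lab, ihl, ihr]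

theorem Tree.lab_eq_of_shape_eq {t u : Tree S} (h : t.shape = u.shape) : t.lab = u.lab := by
  rw [← t.lab_shape, h, u.lab_shape]

/-- The properties of the straddle-tree of a down-closed family of sets on which the costs depend:
labels increase downwards, and labels that occur to the right of a vertex also occur to its left. -/
def Tree.Good [LT S] : Tree S → Prop
  | .leaf _ => True
  | .node x l r => (∀ y ∈ l.lab, x < y) ∧ r.lab ⊆ l.lab ∧ l.Good ∧ r.Good

theorem Tree.good_shape [LT S] (t : Tree S) : t.shape.Good ↔ t.Good := by
  induction t with
  | leaf a => rfl
  | node x l r ihl ihr => simp only [Tree.shape, Tree.Good, Tree.lab_shape, ihl, ihr]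

theorem Tree.good_of_shape_eq [LT S] {t u : Tree S} (h : t.shape = u.shape) (hu : u.Good) :
    t.Good := by
  rwa [← t.good_shape, h, u.good_shape]

/-- `t` has the shape of the complete straddle-tree of the power set of `D`, as far as labels and
number of vertices are concerned. -/
def Tree.Full [LT S] (D : Finset S) (t : Tree S) : Prop :=
  t.Good ∧ t.lab = D ∧ t.size + 1 = 2 ^ (D.card + 1)

theorem Tree.full_of_shape_eq [LT S] {D : Finset S} {t u : Tree S} (h : t.shape = u.shape)
    (hu : u.Full D) : t.Full D :=
  ⟨Tree.good_of_shape_eq h hu.1, (Tree.lab_eq_of_shape_eq h).trans hu.2.1,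
    Tree.size_eq_of_shape_eq h ▸ hu.2.2⟩

theorem Tree.Good.lab_node [LT S] {x : S} {l r : Tree S} (h : (Tree.node x l r).Good) :
    (Tree.node x l r).lab = insert x l.lab := by
  rw [Tree.lab, Finset.union_eq_left.2 h.2.1]

theorem Tree.Good.lt_of_mem [Preorder S] {x : S} {l r : Tree S} (h : (Tree.node x l r).Good) :
    ∀ y ∈ l.lab ∪ r.lab, x < y := by
  rw [Finset.union_eq_left.2 h.2.1]
  exact h.1

theorem Tree.Good.card_lab_node [Preorder S] {x : S} {l r : Tree S}
    (h : (Tree.node x l r).Good) : (Tree.node x l r).lab.card = l.lab.card + 1 := by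
  rw [h.lab_node, Finset.card_insert_of_notMem fun hx => lt_irrefl _ (h.1 x hx)]

theorem Tree.Good.spine_eq [Preorder S] {t : Tree S} (h : t.Good) : t.spine = t.lab.card := by
  induction t with
  | leaf a => rfl
  | node x l r ihl ihr => rw [h.card_lab_node, Tree.spine, ihl h.2.2.1]

theorem Tree.Good.size_lt [Preorder S] {t : Tree S} (h : t.Good) :
    t.size < 2 ^ (t.lab.card + 1) := by
  induction t with
  | leaf a => simp [Tree.lab, Tree.size]
  | node x l r ihl ihr =>
    have h₁ := ihl h.2.2.1
    have h₂ := ihr h.2.2.2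
    have h₃ : 2 ^ (r.lab.card + 1) ≤ 2 ^ (l.lab.card + 1) :=
      Nat.pow_le_pow_right (by omega) (by have := Finset.card_le_card h.2.1; omega)
    rw [h.card_lab_node, Tree.size, pow_succ 2 (l.lab.card + 1)]
    omega

end Shapes

/-! ### Copying, creating and deleting trees -/

section Copies

variable {S R : Type} {c : Config S}

theorem triple_copyVertices (t : Tree S) :
    Triple (R := R) (copyVertices t) c 0 (4 * t.size) (2 * t.size)
      (fun u c' m => u.shape = t.shape ∧ c' = c ∧ m = t.size) := by
  induction t with
  | leaf a =>
    refine Triple.bind 0 (triple_readLeaf a) rfl (by simp [Tree.size]) (by simp) ?_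
    rintro _ _ _ ⟨rfl, rfl⟩
    refine Triple.conseq 0 (triple_newLeaf _) rfl (by simp [Tree.size]) (by simp [Tree.size]) ?_
    rintro _ _ _ ⟨⟨a, rfl⟩, rfl, rfl⟩
    exact ⟨rfl, rfl, rfl⟩
  | node x l r ihl ihr =>
    have hl := l.one_le_size
    have hr := r.one_le_size
    refine Triple.call (τ₁ := 4 * l.size + 4 * r.size + 1) (π₁ := 2 * l.size + 2 * r.size) ?_
      (by simp only [Tree.size]; omega) (by simp only [Tree.size]; omega)
      (by simp only [Tree.size]; omega)
    refine Triple.bind 0 ihl rfl (by omega) (by omega) ?_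
    rintro l' _ _ ⟨hl', rfl, rfl⟩
    refine Triple.bind l.size ihr (by omega) (by omega) (by omega) ?_
    rintro r' _ _ ⟨hr', rfl, rfl⟩
    refine Triple.conseq (r.size + l.size) (triple_newNode _ _ _) (by omega) (by omega)
      (by omega) ?_
    rintro _ _ _ ⟨rfl, rfl, rfl⟩
    exact ⟨by simp [Tree.shape, hl', hr'], rfl, by simp only [Tree.size]; omega⟩

theorem triple_copyTree (t : Tree S) :
    Triple (R := R) (copyTree t) c 0 (5 * t.size) (3 * t.size)
      (fun u c' m => u.shape = t.shape ∧ c' = c ∧ m = t.size + 1) := by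
  have ht := t.one_le_size
  refine Triple.bind 0 (triple_alloc 1) rfl (by omega) (by omega) ?_
  rintro _ _ _ ⟨rfl, rfl⟩
  refine Triple.conseq 1 (triple_copyVertices t) rfl (by omega) (by omega) ?_
  rintro u _ _ ⟨hu, rfl, rfl⟩
  exact ⟨hu, rfl, rfl⟩

theorem triple_dispose (t : Tree S) :
    Triple (R := R) (dispose t) c (t.size + 1) (t.size + 1) (t.size + 1)
      (fun _ c' m => c' = c ∧ m = 0) :=
  triple_free _

theorem triple_newVertices [LinearOrder S] {D : List S} (hD : D.Pairwise (· < ·))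
    (g : Finset S → R) :
    Triple (newVertices D g) c 0 (4 * 2 ^ (D.length + 1) - 3) (2 * 2 ^ (D.length + 1))
      (fun t c' m => t.Full D.toFinset ∧ c' = c ∧ m + 1 = 2 ^ (D.length + 1)) := by
  induction D generalizing g with
  | nil =>
    refine Triple.conseq 0 (triple_newLeaf _) rfl (by simp) (by simp) ?_
    rintro _ _ _ ⟨⟨a, rfl⟩, rfl, rfl⟩
    exact ⟨⟨trivial, rfl, rfl⟩, rfl, rfl⟩
  | cons x D ih =>
    rw [List.pairwise_cons] at hD
    have ih := ih hD.2
    have hpos : 0 < 2 ^ D.length := by positivity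
    simp only [List.length_cons, pow_succ] at ih ⊢
    refine Triple.call (τ₁ := 16 * 2 ^ D.length - 5) (π₁ := 8 * 2 ^ D.length - 1) ?_
      (by omega) (by omega) (by omega)
    refine Triple.bind 0 (ih g) rfl (by omega) (by omega) ?_
    rintro l _ m₁ ⟨hl, rfl, h₁⟩
    refine Triple.bind m₁ (ih _) (by omega) (by omega) (by omega) ?_
    rintro r _ m₂ ⟨hr, rfl, h₂⟩
    refine Triple.conseq (m₂ + m₁) (triple_newNode _ _ _) (by omega) (by omega) (by omega) ?_
    rintro _ _ _ ⟨rfl, rfl, rfl⟩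
    have hx : x ∉ D.toFinset := fun h => lt_irrefl _ (hD.1 x (List.mem_toFinset.1 h))
    refine ⟨⟨⟨?_, ?_, hl.1, hr.1⟩, ?_, ?_⟩, rfl, by omega⟩
    · intro y hy
      rw [hl.2.1, List.mem_toFinset] at hy
      exact hD.1 y hy
    · rw [hl.2.1, hr.2.1]
    · simp [Tree.lab, hl.2.1, hr.2.1]
    · have h₃ := hl.2.2
      have h₄ := hr.2.2
      rw [List.toFinset_cons, Finset.card_insert_of_notMem hx]
      simp only [Tree.size, pow_succ] at h₃ h₄ ⊢
      omega

theorem triple_newTree [LinearOrder S] (D : Finset S) (g : Finset S → R) :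
    Triple (newTree D g) c 0 (10 * 2 ^ D.card) (6 * 2 ^ D.card)
      (fun t c' m => t.Full D ∧ c' = c ∧ m = 2 ^ (D.card + 1)) := by
  have hpos : 0 < 2 ^ D.card := by positivity
  have h := triple_newVertices (c := c) (D.sortedLT_sort).pairwise g
  rw [Finset.length_sort, Finset.sort_toFinset] at h
  simp only [pow_succ] at h ⊢
  refine Triple.bind 0 (triple_alloc 1) rfl (by omega) (by omega) ?_
  rintro _ _ _ ⟨rfl, rfl⟩
  refine Triple.conseq 1 h rfl (by omega) (by omega) ?_
  rintro t _ m ⟨ht, rfl, hm⟩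
  exact ⟨ht, rfl, hm⟩

end Copies

/-! ### Finding the labels of given trees -/

section Labels

variable {S R : Type}

/-- The configuration between two searches. -/
def Config.clean : Config S := ⟨fun _ => [], [], fun _ => false⟩

theorem triple_collect [DecidableEq S] (t : Tree S) {c : Config S} {acc : List S}
    (hn : acc.Nodup) (hc : ∀ x, c.mark x = true ↔ x ∈ acc) :
    Triple (R := R) (collect t acc) c 0 (4 * t.size) (2 * t.size)
      (fun l c' m => c'.array = c.array ∧ c'.found = c.found ∧ l.Nodup ∧
        (∀ x, c'.mark x = true ↔ x ∈ l) ∧ (∀ x, x ∈ l ↔ x ∈ acc ∨ x ∈ t.lab) ∧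
        m + acc.length = l.length ∧ m ≤ t.size) := by
  induction t generalizing c acc with
  | leaf a =>
    refine Triple.bind 0 (triple_spend 1) rfl (by simp [Tree.size]) (by simp) ?_
    rintro _ c _ ⟨rfl, rfl⟩
    exact Triple.pure ⟨rfl, rfl, hn, hc, by simp [Tree.lab], by simp, by simp⟩
  | node x l r ihl ihr =>
    have h₁ := l.one_le_size
    have h₂ := r.one_le_size
    refine Triple.call (τ₁ := 4 * l.size + 4 * r.size + 2) (π₁ := 2 * l.size + 2 * r.size + 1) ?_
      (by simp only [Tree.size]; omega) (by simp only [Tree.size]; omega)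
      (by simp only [Tree.size]; omega)
    refine Triple.bind 0 (triple_spend 1) rfl (by omega) (by omega) ?_
    rintro _ c _ ⟨rfl, rfl⟩
    refine Triple.get fun s hs => ?_
    have hm : s.mark = c.mark := by rw [← hs]; rfl
    rw [hm]
    split
    · rename_i hx
      refine Triple.bind 0 (ihl hn hc) rfl (by omega) (by omega) ?_
      rintro l₁ c₁ m₁ ⟨ha₁, hf₁, hn₁, hc₁, hl₁, hm₁, hs₁⟩
      refine Triple.conseq m₁ (ihr hn₁ hc₁) (by omega) (by omega) (by omega) ?_
      rintro l₂ c₂ m₂ ⟨ha₂, hf₂, hn₂, hc₂, hl₂, hm₂, hs₂⟩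
      refine ⟨ha₂.trans ha₁, hf₂.trans hf₁, hn₂, hc₂, ?_, by omega,
        by simp only [Tree.size]; omega⟩
      intro y
      rw [hl₂, hl₁, Tree.lab, Finset.mem_insert, Finset.mem_union]
      have : y = x → y ∈ acc := fun h => h ▸ (hc x).1 hx
      tauto
    · rename_i hx
      refine Triple.bind 0 (triple_alloc 1) rfl (by omega) (by omega) ?_
      rintro _ c _ ⟨rfl, rfl⟩
      refine Triple.get_set ?_
      refine Triple.bind (c := c) 1
        (triple_modify (c' := { c with mark := Function.update c.mark x true })
          ?_ ?_ ?_ ?_) (by omega) (by omega) (by omega) ?_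
      · rintro s rfl; rfl
      · exact fun _ => rfl
      · exact fun _ => rfl
      · exact fun _ => rfl
      rintro _ c _ ⟨rfl, rfl⟩
      have hx' : x ∉ acc := fun h => hx ((hc x).2 h)
      refine Triple.bind 1 (ihl (acc := x :: acc) (List.nodup_cons.2 ⟨hx', hn⟩) ?_)
        (by omega) (by omega) (by omega) ?_
      · intro y
        by_cases hy : y = x
        · simp [hy]
        · simp [hy, hc]
      rintro l₁ c₁ m₁ ⟨ha₁, hf₁, hn₁, hc₁, hl₁, hm₁, hs₁⟩
      refine Triple.conseq (m₁ + 1) (ihr hn₁ hc₁) (by omega) (by omega) (by omega) ?_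
      rintro l₂ c₂ m₂ ⟨ha₂, hf₂, hn₂, hc₂, hl₂, hm₂, hs₂⟩
      rw [List.length_cons] at hm₁
      refine ⟨ha₂.trans ha₁, hf₂.trans hf₁, hn₂, hc₂, ?_, by omega,
        by simp only [Tree.size]; omega⟩
      intro y
      rw [hl₂, hl₁, Tree.lab, Finset.mem_insert, Finset.mem_union, List.mem_cons]
      tauto

theorem triple_collectAll [DecidableEq S] (ts : List (ℕ × Tree S)) {c : Config S} {acc : List S}
    (hn : acc.Nodup) (hc : ∀ x, c.mark x = true ↔ x ∈ acc) :
    Triple (R := R) (collectAll ts acc) c 0 (5 * (ts.map fun v => v.2.size).sum + 1)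
      (2 * (ts.map fun v => v.2.size).sum)
      (fun l c' m => c'.array = c.array ∧ c'.found = c.found ∧ l.Nodup ∧
        (∀ x, c'.mark x = true ↔ x ∈ l) ∧ (∀ x, x ∈ l ↔ x ∈ acc ∨ ∃ v ∈ ts, x ∈ v.2.lab) ∧
        m + acc.length = l.length ∧ m ≤ (ts.map fun v => v.2.size).sum) := by
  induction ts generalizing c acc with
  | nil =>
    refine Triple.bind 0 (triple_spend 1) rfl (by simp) (by simp) ?_
    rintro _ c _ ⟨rfl, rfl⟩
    exact Triple.pure ⟨rfl, rfl, hn, hc, by simp, by simp, by simp⟩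
  | cons v ts ih =>
    obtain ⟨i, t⟩ := v
    have h₁ := t.one_le_size
    simp only [List.map_cons, List.sum_cons]
    refine Triple.bind 0 (triple_spend 1) rfl (by omega) (by omega) ?_
    rintro _ c _ ⟨rfl, rfl⟩
    refine Triple.bind 0 (triple_collect t hn hc) rfl (by omega) (by omega) ?_
    rintro l₁ c₁ m₁ ⟨ha₁, hf₁, hn₁, hc₁, hl₁, hm₁, hs₁⟩
    refine Triple.conseq m₁ (ih hn₁ hc₁) (by omega) (by omega) (by omega) ?_
    rintro l₂ c₂ m₂ ⟨ha₂, hf₂, hn₂, hc₂, hl₂, hm₂, hs₂⟩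
    refine ⟨ha₂.trans ha₁, hf₂.trans hf₁, hn₂, hc₂, ?_, by omega, by omega⟩
    intro y
    rw [hl₂, hl₁, List.exists_mem_cons_iff]
    tauto

theorem triple_unmark [DecidableEq S] (l : List S) {c : Config S} :
    Triple (R := R) (forEach unmark l) c 0 (2 * l.length + 1) 0
      (fun _ c' m => c' = { c with mark := fun x => if x ∈ l then false else c.mark x } ∧
        m = 0) := by
  induction l generalizing c with
  | nil =>
    refine Triple.conseq 0 (triple_spend 1) rfl (by simp) le_rfl ?_
    rintro _ c _ ⟨rfl, rfl⟩
    exact ⟨by simp, rfl⟩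
  | cons x l ih =>
    rw [List.length_cons]
    refine Triple.bind 0 (triple_spend 1) rfl (by omega) (by omega) ?_
    rintro _ c _ ⟨rfl, rfl⟩
    have hx : Triple (R := R) (unmark x) c 0 1 0 (fun _ c' m =>
        c' = { c with mark := Function.update c.mark x false } ∧ m = 0) := by
      refine Triple.bind 0 (triple_spend 1) rfl (by omega) (by omega) ?_
      rintro _ c _ ⟨rfl, rfl⟩
      refine Triple.conseq 0 (triple_modify ?_ (fun _ => rfl) (fun _ => rfl) (fun _ => rfl))
        rfl (by omega) (by omega) (fun _ _ _ h => h)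
      rintro s rfl
      rfl
    refine Triple.bind 0 hx rfl (by omega) (by omega) ?_
    rintro _ c _ ⟨rfl, rfl⟩
    refine Triple.conseq 0 ih rfl (by omega) (by omega) ?_
    rintro _ c _ ⟨rfl, rfl⟩
    refine ⟨?_, rfl⟩
    congr 1
    ext y
    by_cases hy : y = x <;> simp [hy]

theorem triple_insertLabel [LinearOrder S] (x : S) {l : List S} (hl : l.Pairwise (· < ·))
    (hx : x ∉ l) {c : Config S} :
    Triple (R := R) (insertLabel x l) c 0 (l.length + 1) 0
      (fun l' c' m => l'.Pairwise (· < ·) ∧ l'.Perm (x :: l) ∧ c' = c ∧ m = 0) := by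
  induction l with
  | nil =>
    refine Triple.bind 0 (triple_spend 1) rfl (by simp) (by simp) ?_
    rintro _ c _ ⟨rfl, rfl⟩
    exact Triple.pure ⟨by simp, .refl _, rfl, rfl⟩
  | cons y l ih =>
    rw [List.mem_cons, not_or] at hx
    rw [List.length_cons]
    refine Triple.bind 0 (triple_spend 1) rfl (by omega) (by omega) ?_
    rintro _ c _ ⟨rfl, rfl⟩
    split
    · rename_i hxy
      have hxy := lt_of_le_of_ne hxy hx.1
      refine Triple.pure ⟨List.pairwise_cons.2 ⟨?_, hl⟩, .refl _, rfl, rfl⟩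
      rintro z (_ | ⟨_, hz⟩)
      · exact hxy
      · exact hxy.trans ((List.pairwise_cons.1 hl).1 z hz)
    · rename_i hxy
      rw [List.pairwise_cons] at hl
      refine Triple.bind 0 (ih hl.2 hx.2) rfl (by omega) (by omega) ?_
      rintro l' _ _ ⟨hl', hp, rfl, rfl⟩
      refine Triple.pure ⟨List.pairwise_cons.2 ⟨?_, hl'⟩, ?_, rfl, rfl⟩
      · intro z hz
        rcases List.mem_cons.1 (hp.subset hz) with rfl | hz
        · exact not_le.1 hxy
        · exact hl.1 z hz
      · exact (hp.cons y).trans (List.Perm.swap x y l)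

theorem triple_sortLabels [LinearOrder S] (l : List S) {sorted : List S}
    (hs : sorted.Pairwise (· < ·)) (hn : (l ++ sorted).Nodup) {c : Config S} :
    Triple (R := R) (sortLabels l sorted) c 0
      (l.length * (l.length + sorted.length + 2) + 1) 0
      (fun l' c' m => l'.Pairwise (· < ·) ∧ l'.Perm (l ++ sorted) ∧ c' = c ∧ m = 0) := by
  induction l generalizing sorted with
  | nil =>
    refine Triple.bind 0 (triple_spend 1) rfl (by simp) (by simp) ?_
    rintro _ c _ ⟨rfl, rfl⟩
    exact Triple.pure ⟨hs, .refl _, rfl, rfl⟩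
  | cons x l ih =>
    have hsize : (x :: l).length * ((x :: l).length + sorted.length + 2) + 1
        = l.length * (l.length + (sorted.length + 1) + 2) + 1 + (l.length + sorted.length + 3) := by
      rw [List.length_cons]
      ring
    rw [hsize]
    rw [List.cons_append, List.nodup_cons, List.mem_append, not_or] at hn
    refine Triple.bind 0 (triple_spend 1) rfl (by omega) (by omega) ?_
    rintro _ c _ ⟨rfl, rfl⟩
    refine Triple.bind 0 (triple_insertLabel x hs hn.1.2) rfl (by omega) (by omega) ?_
    rintro s' _ _ ⟨hs', hp, rfl, rfl⟩
    have hp' : (l ++ s').Perm (x :: (l ++ sorted)) :=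
      (hp.append_left l).trans List.perm_middle
    have ih := ih hs' (hp'.nodup_iff.2 (List.nodup_cons.2 ⟨by simp [hn.1], hn.2⟩))
    rw [hp.length_eq, List.length_cons] at ih
    refine Triple.conseq 0 ih rfl (by omega) (by omega) ?_
    rintro l' _ _ ⟨hl', hq, rfl, rfl⟩
    exact ⟨hl', hq.trans hp', rfl, rfl⟩

theorem sq_le_two_mul_two_pow (n : ℕ) : n * n ≤ 2 * 2 ^ n := by
  induction n with
  | zero => simp
  | succ k ih =>
    rcases Nat.lt_or_ge k 3 with h | h
    · interval_cases k <;> norm_num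
    · have : 3 * k ≤ k * k := Nat.mul_le_mul_right k h
      rw [pow_succ]
      ring_nf at *
      omega

/-- The quadratic cost of the insertion sort is absorbed by the cost of a ghost-search. -/
theorem triple_labels [LinearOrder S] (ts : List (ℕ × Tree S)) (U : Finset S)
    (hU : ∀ x, x ∈ U ↔ ∃ v ∈ ts, x ∈ v.2.lab) :
    Triple (R := R) (labels ts) Config.clean 0
      (5 * (ts.map fun v => v.2.size).sum + 9 * 2 ^ U.card)
      (2 * (ts.map fun v => v.2.size).sum)
      (fun X c' m => X.Pairwise (· < ·) ∧ X.toFinset = U ∧ X.length = U.card ∧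
        c' = Config.clean ∧ m = U.card ∧ m ≤ (ts.map fun v => v.2.size).sum) := by
  have h₁ := sq_le_two_mul_two_pow U.card
  have h₂ : U.card < 2 ^ U.card := Nat.lt_two_pow_self
  refine Triple.bind 0 (triple_collectAll ts List.nodup_nil (by simp [Config.clean])) rfl
    (by omega) (by omega) ?_
  rintro l c₁ m ⟨ha, hf, hn, hc, hl, hm, hs⟩
  have hlU : l.toFinset = U := by
    ext x
    simp [hl, hU]
  have hlen : l.length = U.card := by rw [← hlU, List.toFinset_card_of_nodup hn]
  rw [List.length_nil] at hm
  refine Triple.bind m (triple_unmark l) (by omega) (by omega) (by omega) ?_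
  rintro _ c _ ⟨rfl, rfl⟩
  have hclean : ({ c₁ with mark := fun x => if x ∈ l then false else c₁.mark x } : Config S)
      = Config.clean := by
    obtain ⟨a, f, k⟩ := c₁
    simp only at ha hf hc
    subst ha hf
    simp only [Config.clean, Config.mk.injEq, true_and]
    funext x
    simpa using fun hx => by_contra fun h => hx ((hc x).1 (by simpa using h))
  rw [hclean]
  have hsort := triple_sortLabels (R := R) l (sorted := []) List.Pairwise.nil (by simpa using hn)
    (c := Config.clean)
  rw [hlen] at hsort
  refine Triple.conseq m hsort (by omega) ?_ (by omega) ?_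
  · rw [List.length_nil, add_zero, mul_add]
    omega
  · rintro X _ _ ⟨hX, hp, rfl, rfl⟩
    rw [List.append_nil] at hp
    refine ⟨hX, ?_, ?_, rfl, by omega, by omega⟩
    · rw [← hlU]
      exact List.toFinset_eq_of_perm _ _ hp
    · rw [hp.length_eq, hlen]

end Labels

/-! ### Synchronised searches -/

section Search

variable {S R : Type}

/-- The topmost vertices among those that a ghost-search of the set `X` will still meet: those in
the sets `𝒜(e)` for `e ∈ X`, and the leaves in `ℒ`. -/
def Config.pending (X : List S) (c : Config S) : Multiset (Tree S) :=
  ((X.flatMap c.array).map Prod.snd : List (Tree S)) +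
    (c.found.map fun l => Tree.leaf l.2 : List (Tree S))

/-- The total number of vertices of several trees. -/
def totalSize (M : Multiset (Tree S)) : ℕ := (M.map Tree.size).sum

@[simp] theorem totalSize_zero : totalSize (0 : Multiset (Tree S)) = 0 := rfl

@[simp] theorem totalSize_add (M N : Multiset (Tree S)) :
    totalSize (M + N) = totalSize M + totalSize N := by
  simp [totalSize]

@[simp] theorem totalSize_coe (l : List (Tree S)) :
    totalSize (l : Multiset (Tree S)) = (l.map Tree.size).sum := by
  simp [totalSize]

theorem card_le_totalSize (M : Multiset (Tree S)) : M.card ≤ totalSize M := by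
  induction M using Multiset.induction with
  | empty => simp
  | cons t M ih =>
    have := t.one_le_size
    simp only [totalSize, Multiset.map_cons, Multiset.sum_cons, Multiset.card_cons] at ih ⊢
    omega

theorem Config.pending_cons (e : S) (X : List S) (c : Config S) :
    c.pending (e :: X) = ((c.array e).map Prod.snd : List (Tree S)) + c.pending X := by
  simp only [Config.pending, List.flatMap_cons, List.map_append, ← Multiset.coe_add, add_assoc]

/-- The left child of a vertex (a leaf is left as it is). -/
def Tree.leftChild : Tree S → Tree S
  | .leaf a => .leaf a
  | .node _ l _ => l

/-- The right child of a vertex (a leaf is left as it is). -/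
def Tree.rightChild : Tree S → Tree S
  | .leaf a => .leaf a
  | .node _ _ r => r

theorem sum_size_children {e : S} {N : List (ℕ × Tree S)}
    (hN : ∀ v ∈ N, (∃ l r, v.2 = Tree.node e l r)) :
    ((N.map Prod.snd).map Tree.size).sum = N.length
      + ((N.map fun v => v.2.leftChild).map Tree.size).sum
      + ((N.map fun v => v.2.rightChild).map Tree.size).sum := by
  induction N with
  | nil => rfl
  | cons v N ih =>
    obtain ⟨⟨l, r, hv⟩, hN⟩ := List.forall_mem_cons.1 hN
    simp only [List.map_cons, List.sum_cons, ih hN, hv, List.length_cons, Tree.leftChild,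
      Tree.rightChild, Tree.size]
    omega

theorem triple_clearFound {c : Config S} :
    Triple (R := R) clearFound c c.found.length (1 + c.found.length) c.found.length
      (fun _ c' m => c' = { c with found := [] } ∧ m = 0) := by
  refine Triple.bind c.found.length (triple_spend 1) (by omega) (by omega) (by omega) ?_
  rintro _ c _ ⟨rfl, rfl⟩
  refine Triple.get fun s hs => ?_
  have hf : s.found = c.found := by rw [← hs]; rfl
  rw [hf]
  refine Triple.bind 0 (triple_free _) (by omega) (by omega) (by omega) ?_
  rintro _ c _ ⟨rfl, rfl⟩
  refine Triple.conseq 0 (triple_modify ?_ (fun _ => rfl) (fun _ => rfl) (fun _ => rfl))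
    rfl (by omega) (by omega) (fun _ _ _ h => h)
  rintro s rfl
  rfl

variable [LinearOrder S]

/-- The effect of `place`. -/
def Config.place (c : Config S) : ℕ × Tree S → Config S
  | (i, .leaf a) => { c with found := (i, a) :: c.found }
  | (i, .node x l r) =>
    { c with array := Function.update c.array x ((i, .node x l r) :: c.array x) }

/-- The effect of the operations `𝒜(e) ← ∅`, for `e ∈ X`, and `ℒ ← ∅`. -/
def Config.cleared (X : List S) (c : Config S) : Config S :=
  ⟨fun e => if e ∈ X then [] else c.array e, [], c.mark⟩

/-- The vertices in `𝒜(e)`, for `e ∈ X`, have the label `e`, and are roots of straddle-trees with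
labels in `X`. -/
def Config.Sound (X : List S) (c : Config S) : Prop :=
  ∀ e ∈ X, ∀ v ∈ c.array e, (∃ l r, v.2 = Tree.node e l r) ∧ v.2.Good ∧ ∀ y ∈ v.2.lab, y ∈ X

theorem flatMap_update_perm {β : Type} {f : S → List β} {x : S} {b : β} {X : List S}
    (hX : X.Nodup) (hx : x ∈ X) :
    (X.flatMap (Function.update f x (b :: f x))).Perm (b :: X.flatMap f) := by
  induction X with
  | nil => simp at hx
  | cons y X ih =>
    rw [List.nodup_cons] at hX
    rw [List.flatMap_cons, List.flatMap_cons]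
    by_cases hy : x = y
    · subst hy
      rw [Function.update_self, List.cons_append]
      refine List.Perm.of_eq ?_
      congr 2
      refine List.flatMap_congr fun z hz => ?_
      rw [Function.update_of_ne]
      rintro rfl
      exact hX.1 hz
    · rw [Function.update_of_ne (Ne.symm hy)]
      exact ((ih hX.2 ((List.mem_cons.1 hx).resolve_left hy)).append_left (f y)).trans
        List.perm_middle

theorem Config.pending_place {X : List S} (hX : X.Nodup) {c : Config S} {v : ℕ × Tree S}
    (hv : ∀ y ∈ v.2.lab, y ∈ X) : (c.place v).pending X = v.2 ::ₘ c.pending X := by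
  obtain ⟨i, _ | ⟨x, l, r⟩⟩ := v
  · simp [Config.pending, Config.place, Multiset.add_cons, ← Multiset.cons_coe]
  · have hx : x ∈ X := hv x (by simp [Tree.lab])
    simp only [Config.pending, Config.place]
    rw [Multiset.coe_eq_coe.2 ((flatMap_update_perm hX hx).map Prod.snd), List.map_cons,
      ← Multiset.cons_coe, Multiset.cons_add]

theorem Config.cleared_place {X : List S} {c : Config S} {v : ℕ × Tree S}
    (hv : ∀ y ∈ v.2.lab, y ∈ X) : (c.place v).cleared X = c.cleared X := by
  obtain ⟨i, _ | ⟨x, l, r⟩⟩ := v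
  · rfl
  · have hx : x ∈ X := hv x (by simp [Tree.lab])
    simp only [Config.cleared, Config.place, Config.mk.injEq, and_self, and_true]
    funext e
    by_cases he : e = x
    · simp [he, hx]
    · simp [he]

theorem Config.array_place {X : List S} {c : Config S} {v : ℕ × Tree S}
    (hv : ∀ y ∈ v.2.lab, y ∈ X) {e : S} (he : e ∉ X) : (c.place v).array e = c.array e := by
  obtain ⟨i, _ | ⟨x, l, r⟩⟩ := v
  · rfl
  · refine Function.update_of_ne ?_ _ _
    rintro rfl
    exact he (hv e (by simp [Tree.lab]))

theorem Config.Sound.place {X : List S} {c : Config S} (hc : c.Sound X) {v : ℕ × Tree S}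
    (hg : v.2.Good) (hv : ∀ y ∈ v.2.lab, y ∈ X) : (c.place v).Sound X := by
  obtain ⟨i, _ | ⟨x, l, r⟩⟩ := v
  · exact hc
  · intro e he w hw
    by_cases hex : e = x
    · subst hex
      simp only [Config.place, Function.update_self, List.mem_cons] at hw
      rcases hw with rfl | hw
      · exact ⟨⟨l, r, rfl⟩, hg, hv⟩
      · exact hc e he w hw
    · simp only [Config.place, Function.update_of_ne hex] at hw
      exact hc e he w hw

/-- The effect of placing several vertices one after the other. -/
theorem Config.placeAll {X : List S} (hX : X.Nodup) {c : Config S} {vs : List (ℕ × Tree S)}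
    (hc : c.Sound X) (hg : ∀ v ∈ vs, v.2.Good ∧ ∀ y ∈ v.2.lab, y ∈ X) :
    (vs.foldl Config.place c).pending X = (vs.map Prod.snd : List (Tree S)) + c.pending X ∧
      (vs.foldl Config.place c).cleared X = c.cleared X ∧
      (∀ e ∉ X, (vs.foldl Config.place c).array e = c.array e) ∧
      (vs.foldl Config.place c).Sound X := by
  induction vs generalizing c with
  | nil => exact ⟨by simp, rfl, fun _ _ => rfl, hc⟩
  | cons v vs ih =>
    obtain ⟨hv, hvs⟩ := List.forall_mem_cons.1 hg
    obtain ⟨h₁, h₂, h₃, h₄⟩ := ih (hc.place hv.1 hv.2) hvs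
    refine ⟨?_, ?_, ?_, h₄⟩
    · rw [List.foldl_cons, h₁, Config.pending_place hX hv.2, List.map_cons, ← Multiset.cons_coe,
        Multiset.cons_add, Multiset.add_cons]
    · rw [List.foldl_cons, h₂, Config.cleared_place hv.2]
    · intro e he
      rw [List.foldl_cons, h₃ e he, Config.array_place hv.2 he]

variable {c : Config S}

theorem triple_place (v : ℕ × Tree S) :
    Triple (R := R) (place v) c 0 1 1 (fun _ c' m => c' = c.place v ∧ m = 1) := by
  obtain ⟨i, _ | ⟨x, l, r⟩⟩ := v
  all_goals
    refine Triple.bind 0 (triple_alloc 1) rfl (by omega) (by omega) ?_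
    rintro _ c _ ⟨rfl, rfl⟩
    refine Triple.conseq 1 (triple_modify ?_ (fun _ => rfl) (fun _ => rfl) (fun _ => rfl))
        rfl (by omega) (by omega) (fun _ _ _ h => ⟨h.1, by omega⟩)
    rintro s rfl
    rfl

theorem triple_forEach_place {f : ℕ × Tree S → Prog S R Unit} {g : ℕ × Tree S → ℕ × Tree S}
    {vs : List (ℕ × Tree S)}
    (h : ∀ v ∈ vs, ∀ c, Triple (f v) c 0 1 1 (fun _ c' m => c' = c.place (g v) ∧ m = 1)) :
    Triple (forEach f vs) c 0 (2 * vs.length + 1) vs.length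
      (fun _ c' m => c' = (vs.map g).foldl Config.place c ∧ m = vs.length) := by
  induction vs generalizing c with
  | nil =>
    exact Triple.conseq 0 (triple_spend 1) rfl (by simp) (by simp) (fun _ _ _ h => h)
  | cons v vs ih =>
    rw [List.length_cons]
    refine Triple.bind 0 (triple_spend 1) rfl (by omega) (by omega) ?_
    rintro _ c _ ⟨rfl, rfl⟩
    refine Triple.bind 0 (h v List.mem_cons_self c) rfl (by omega) (by omega) ?_
    rintro _ _ _ ⟨rfl, rfl⟩
    refine Triple.conseq 1 (ih fun w hw => h w (List.mem_cons_of_mem _ hw)) rfl (by omega)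
      (by omega) ?_
    rintro _ _ _ ⟨rfl, rfl⟩
    exact ⟨rfl, rfl⟩

theorem triple_clearArray (e : S) :
    Triple (R := R) (clearArray e) c (c.array e).length (1 + (c.array e).length)
      (c.array e).length
      (fun _ c' m => c' = { c with array := Function.update c.array e [] } ∧ m = 0) := by
  refine Triple.bind (c.array e).length (triple_spend 1) (by omega) (by omega) (by omega) ?_
  rintro _ c _ ⟨rfl, rfl⟩
  refine Triple.get fun s hs => ?_
  have hf : s.array = c.array := by rw [← hs]; rfl
  rw [hf]
  refine Triple.bind 0 (triple_free _) (by omega) (by omega) (by omega) ?_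
  rintro _ c _ ⟨rfl, rfl⟩
  refine Triple.conseq 0 (triple_modify ?_ (fun _ => rfl) (fun _ => rfl) (fun _ => rfl))
    rfl (by omega) (by omega) (fun _ _ _ h => h)
  rintro s rfl
  rfl

/-- What the leaf-step and the join of a search have to satisfy for the analysis of its costs.
`built a` is the number of cells occupied by what has been built, and `Q M a` says that `a` may be
built from the trees in `M`. -/
structure SearchSpec {α : Type} (leafStep : List (ℕ × ℕ) → Prog S R α)
    (join : S → Bool → α → α → Prog S R α) (built : α → ℕ) (Q : Multiset (Tree S) → α → Prop) :
    Prop where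
  leaf : ∀ c : Config S, Triple (leafStep c.found) c 0 (10 + 10 * c.found.length) 1
    (fun a c' m => Q (c.found.map fun l => Tree.leaf l.2 : List (Tree S)) a ∧ c' = c ∧ m = built a)
  join : ∀ (c : Config S) (e : S) (P : Multiset (Tree S)) (N : List (ℕ × Tree S)) (a b : α),
    (∀ v ∈ P, ∀ y ∈ v.lab, e < y) →
    (∀ v ∈ N, (∃ l r, v.2 = Tree.node e l r) ∧ v.2.Good) →
    Q ((N.map fun v => v.2.leftChild : List (Tree S)) + P) a →
    Q (N.map fun v => v.2.rightChild : List (Tree S)) b →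
    Triple (join e (!N.isEmpty) a b) c (built a + built b) 10 (built a + built b + 1)
      (fun r c' m => Q ((N.map Prod.snd : List (Tree S)) + P) r ∧ c' = c ∧ m = built r)
  built_le : ∀ M a, Q M a → built a ≤ totalSize M

theorem Config.pending_cleared (X : List S) (c : Config S) : (c.cleared X).pending X = 0 := by
  have : X.flatMap (c.cleared X).array = [] := by
    simp only [Config.cleared, List.flatMap_eq_nil_iff]
    intro e he
    simp [he]
  rw [Config.pending, this]
  rfl

/-- The costs of a search: every step of the ghost-search costs a constant, and every vertex of a
searched tree is placed once. In the bound of the memory, `X.length` counts the stack; one half of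
`2 * totalSize` is for the vertices in `𝒜` and `ℒ`, the other one for what is built. -/
theorem triple_search {α : Type} {leafStep : List (ℕ × ℕ) → Prog S R α}
    {join : S → Bool → α → α → Prog S R α} {built : α → ℕ} {Q : Multiset (Tree S) → α → Prop}
    (spec : SearchSpec leafStep join built Q) {X : List S} (hX : X.Pairwise (· < ·))
    {c : Config S} (hc : c.Sound X) :
    Triple (search leafStep join X) c (c.pending X).card
      (60 * (2 * 2 ^ X.length - 1) + 30 * totalSize (c.pending X))
      (X.length + 2 * totalSize (c.pending X) + 2)
      (fun a c' m => Q (c.pending X) a ∧ c' = c.cleared X ∧ m = built a) := by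
  induction X generalizing c with
  | nil =>
    have hp : c.pending [] = (c.found.map fun l => Tree.leaf l.2 : List (Tree S)) := by
      simp [Config.pending]
    have hsize : totalSize (c.pending []) = c.found.length := by
      rw [hp, totalSize_coe, List.map_map]
      simp [Function.comp_def, Tree.size]
    have hcard : (c.pending []).card = c.found.length := by
      rw [hp, Multiset.coe_card, List.length_map]
    have hcl : ({ c with found := [] } : Config S) = c.cleared [] := by
      simp [Config.cleared]
    rw [hsize, hcard, hp, ← hcl]
    simp only [List.length_nil, pow_zero]
    refine Triple.bind c.found.length (triple_spend 1) (by omega) (by omega) (by omega) ?_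
    rintro _ c _ ⟨rfl, rfl⟩
    refine Triple.get fun s hs => ?_
    have hf : s.found = c.found := by rw [← hs]; rfl
    rw [hf]
    refine Triple.bind c.found.length (spec.leaf c) (by omega) (by omega) (by omega) ?_
    rintro a c _ ⟨hQ, rfl, rfl⟩
    have hb := spec.built_le _ _ hQ
    rw [← hp, hsize] at hb
    refine Triple.bind (built a) triple_clearFound (by omega) (by omega) (by omega) ?_
    rintro _ _ _ ⟨rfl, rfl⟩
    exact Triple.pure ⟨hQ, rfl, by omega⟩
  | cons e X ih =>
    rw [List.pairwise_cons] at hX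
    have he : e ∉ X := fun h => lt_irrefl _ (hX.1 e h)
    have hnd : X.Nodup := hX.2.imp fun h => h.ne
    set N := c.array e with hNdef
    set P := c.pending X with hPdef
    have hN : ∀ v ∈ N, (∃ l r, v.2 = Tree.node e l r) ∧ v.2.Good := fun v hv =>
      ⟨(hc e List.mem_cons_self v hv).1, (hc e List.mem_cons_self v hv).2.1⟩
    -- the children of the vertices in `N` have labels in `X`
    have hchild : ∀ v ∈ N, v.2.leftChild.Good ∧ v.2.rightChild.Good ∧
        (∀ y ∈ v.2.leftChild.lab, y ∈ X) ∧ (∀ y ∈ v.2.rightChild.lab, y ∈ X) := by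
      intro v hv
      obtain ⟨⟨l, r, hlr⟩, hg, hl⟩ := hc e List.mem_cons_self v hv
      rw [hlr] at hg hl ⊢
      have hlt : ∀ y ∈ l.lab ∪ r.lab, y ∈ X := fun y hy =>
        (List.mem_cons.1 (hl y (Finset.mem_insert_of_mem hy))).resolve_left
          (hg.lt_of_mem y hy).ne'
      exact ⟨hg.2.2.1, hg.2.2.2, fun y hy => hlt y (Finset.mem_union_left _ hy),
        fun y hy => hlt y (Finset.mem_union_right _ hy)⟩
    have hsound : c.Sound X := by
      intro f hf v hv
      obtain ⟨⟨l, r, hlr⟩, hg, hl⟩ := hc f (List.mem_cons_of_mem _ hf) v hv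
      refine ⟨⟨l, r, hlr⟩, hg, fun y hy => (List.mem_cons.1 (hl y hy)).resolve_left ?_⟩
      rintro rfl
      rw [hlr] at hy hg
      rcases Finset.mem_insert.1 hy with rfl | hy
      · exact he hf
      · exact lt_asymm (hX.1 f hf) (hg.lt_of_mem y hy)
    have hP : ∀ v ∈ P, ∀ y ∈ v.lab, e < y := by
      intro v hv y hy
      simp only [hPdef, Config.pending, Multiset.mem_add, Multiset.mem_coe, List.mem_map,
        List.mem_flatMap] at hv
      rcases hv with ⟨w, ⟨f, hf, hw⟩, rfl⟩ | ⟨w, -, rfl⟩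
      · exact hX.1 y ((hsound f hf w hw).2.2 y hy)
      · simp [Tree.lab] at hy
    have hcl : ∀ d : Config S, d.cleared X = c.cleared X →
        ({ d.cleared X with array := Function.update (d.cleared X).array e [] } : Config S)
          = c.cleared (e :: X) := by
      intro d hd
      rw [hd]
      simp only [Config.cleared, Config.mk.injEq, and_self, and_true]
      funext f
      by_cases hf : f = e
      · simp [hf]
      · simp [hf]
    have hsz := sum_size_children fun v hv => (hN v hv).1
    set L₁ := N.map fun v => v.2.leftChild with hL₁
    set L₂ := N.map fun v => v.2.rightChild with hL₂
    rw [Config.pending_cons, ← hNdef, ← hPdef, Multiset.card_add, Multiset.coe_card,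
      List.length_map, totalSize_add, totalSize_coe, hsz, List.length_cons, pow_succ]
    have hPs := card_le_totalSize P
    have hpos : 0 < 2 ^ X.length := by positivity
    -- by subtracting 1 from `2 * 2 ^ X.length` in the bound, the two searches of `X` leave time 60
    -- for the constant part of the present step
    refine Triple.call
      (τ₁ := 2 * (60 * (2 * 2 ^ X.length - 1)) + 30 + 30 * (N.length + (L₁.map Tree.size).sum
        + (L₂.map Tree.size).sum + totalSize P))
      (π₁ := X.length + 2 * (N.length + (L₁.map Tree.size).sum
        + (L₂.map Tree.size).sum + totalSize P) + 2) ?_ (by omega) (by omega) (by omega)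
    refine Triple.bind (N.length + P.card) (triple_spend 1) (by omega) (by omega) (by omega) ?_
    rintro _ c _ ⟨rfl, rfl⟩
    refine Triple.get fun s hs => ?_
    have hf : s.array = c.array := by rw [← hs]; rfl
    rw [hf, ← hNdef]
    refine Triple.bind (N.length + P.card) (triple_forEach_place
      (g := fun v => (v.1, v.2.leftChild)) ?_) (by omega) (by omega) (by omega) ?_
    · intro v hv d
      obtain ⟨i, t⟩ := v
      obtain ⟨⟨l, r, h⟩, -⟩ := hN _ hv
      simp only at h
      subst h
      exact triple_place (i, l)
    rintro _ c₁ _ ⟨hc₁, rfl⟩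
    obtain ⟨hp₁, hcl₁, ha₁, hs₁⟩ := Config.placeAll (c := c) hnd hsound
      (vs := N.map fun v => (v.1, v.2.leftChild)) (by
        simp only [List.mem_map]
        rintro _ ⟨v, hv, rfl⟩
        exact ⟨(hchild v hv).1, (hchild v hv).2.2.1⟩)
    rw [← hc₁] at hp₁ hcl₁ ha₁ hs₁
    rw [List.map_map, show (Prod.snd ∘ fun v : ℕ × Tree S => (v.1, v.2.leftChild))
      = fun v => v.2.leftChild from rfl, ← hL₁, ← hPdef] at hp₁
    have ih₁ := ih hX.2 hs₁
    have hL₁len : L₁.length = N.length := List.length_map _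
    have hL₂len : L₂.length = N.length := List.length_map _
    rw [hp₁, Multiset.card_add, Multiset.coe_card, totalSize_add, totalSize_coe, hcl₁,
      hL₁len] at ih₁
    refine Triple.bind N.length ih₁ (by omega) (by omega) (by omega) ?_
    -- the vertices in `N` are still in `𝒜(e)`, while all `𝒜(f)` with `f ∈ X` are empty
    rintro a _ _ ⟨hQa, rfl, rfl⟩
    have hba := spec.built_le _ _ hQa
    rw [totalSize_add, totalSize_coe] at hba
    refine Triple.bind (N.length + built a) (triple_spend 1) (by omega) (by omega) (by omega) ?_
    rintro _ c₂ _ ⟨hc₂, rfl⟩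
    refine Triple.get fun s hs => ?_
    have hf₂ : s.array e = N := by
      have : s.array = c₂.array := by rw [← hs]; rfl
      rw [this, hc₂]
      simp [Config.cleared, he, hNdef]
    rw [hf₂]
    refine Triple.bind (N.length + built a) (triple_forEach_place
      (g := fun v => (v.1, v.2.rightChild)) ?_) (by omega) (by omega) (by omega) ?_
    · intro v hv d
      obtain ⟨i, t⟩ := v
      obtain ⟨⟨l, r, h⟩, -⟩ := hN _ hv
      simp only at h
      subst h
      exact triple_place (i, r)
    rintro _ c₃ _ ⟨hc₃, rfl⟩
    have hsound₂ : c₂.Sound X := by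
      intro f hf v hv
      rw [hc₂] at hv
      simp [Config.cleared, hf] at hv
    obtain ⟨hp₃, hcl₃, ha₃, hs₃⟩ := Config.placeAll (c := c₂) hnd hsound₂
      (vs := N.map fun v => (v.1, v.2.rightChild)) (by
        simp only [List.mem_map]
        rintro _ ⟨v, hv, rfl⟩
        exact ⟨(hchild v hv).2.1, (hchild v hv).2.2.2⟩)
    rw [← hc₃] at hp₃ hcl₃ ha₃ hs₃
    rw [List.map_map, show (Prod.snd ∘ fun v : ℕ × Tree S => (v.1, v.2.rightChild))
      = fun v => v.2.rightChild from rfl, ← hL₂, hc₂, Config.pending_cleared, add_zero] at hp₃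
    have hcl₃' : c₃.cleared X = c.cleared X := by
      rw [hcl₃, hc₂]
      simp only [Config.cleared, Config.mk.injEq, and_self, and_true]
      funext f
      split <;> rfl
    have ih₃ := ih hX.2 hs₃
    rw [hp₃, Multiset.coe_card, totalSize_coe, hL₂len] at ih₃
    refine Triple.bind (N.length + built a) ih₃ (by omega) (by omega) (by omega) ?_
    rintro b _ _ ⟨hQb, rfl, rfl⟩
    have hbb := spec.built_le _ _ hQb
    rw [totalSize_coe] at hbb
    refine Triple.bind (N.length + built a + built b) (triple_spend 1) (by omega) (by omega)
      (by omega) ?_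
    rintro _ c₄ _ ⟨hc₄, rfl⟩
    refine Triple.get fun s hs => ?_
    have hN₄ : c₄.array e = N := by
      rw [hc₄, hcl₃']
      simp [Config.cleared, he, hNdef]
    have hf₄ : s.array e = N := by
      have : s.array = c₄.array := by rw [← hs]; rfl
      rw [this, hN₄]
    rw [hf₄]
    refine Triple.bind N.length (spec.join c₄ e P N a b hP hN hQa hQb) (by omega) (by omega)
      (by omega) ?_
    rintro r c₄ _ ⟨hQr, rfl, rfl⟩
    have hbr := spec.built_le _ _ hQr
    rw [totalSize_add, totalSize_coe, hsz] at hbr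
    have hclear := triple_clearArray (R := R) (c := c₄) e
    rw [hN₄] at hclear
    refine Triple.bind (built r) hclear (by omega) (by omega) (by omega) ?_
    rintro _ _ _ ⟨rfl, rfl⟩
    refine Triple.pure ⟨hQr, ?_, by omega⟩
    rw [hc₄]
    exact hcl c₃ hcl₃'

theorem triple_synchronisedSearch {α : Type} {leafStep : List (ℕ × ℕ) → Prog S R α}
    {join : S → Bool → α → α → Prog S R α} {built : α → ℕ} {Q : Multiset (Tree S) → α → Prop}
    (spec : SearchSpec leafStep join built Q) {ts : List (ℕ × Tree S)} {U : Finset S}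
    (hts : ∀ v ∈ ts, v.2.Good) (hU : ∀ x, x ∈ U ↔ ∃ v ∈ ts, x ∈ v.2.lab) :
    Triple (synchronisedSearch leafStep join ts) Config.clean 0
      (200 * (2 ^ U.card + (ts.map fun v => v.2.size).sum))
      (5 * (ts.map fun v => v.2.size).sum + 2)
      (fun a c' m => Q (ts.map Prod.snd : List (Tree S)) a ∧ c' = Config.clean ∧
        m = built a) := by
  have hlen : ts.length ≤ (ts.map fun v => v.2.size).sum := by
    simpa [List.map_map, Function.comp_def] using
      card_le_totalSize ((ts.map Prod.snd : List (Tree S)) : Multiset (Tree S))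
  have hpos : U.card < 2 ^ U.card := Nat.lt_two_pow_self
  refine Triple.bind 0 (triple_labels ts U hU) rfl (by omega) (by omega) ?_
  rintro X _ _ ⟨hX, hXU, hXlen, rfl, rfl, hle⟩
  have hmem : ∀ v ∈ ts, ∀ y ∈ v.2.lab, y ∈ X := by
    intro v hv y hy
    rw [← List.mem_toFinset, hXU, hU]
    exact ⟨v, hv, hy⟩
  have hnd : X.Nodup := hX.imp fun h => h.ne
  refine Triple.bind U.card (triple_forEach_place (g := id) fun v _ c => triple_place v)
    (by omega) (by omega) (by omega) ?_
  rintro _ c _ ⟨hc, rfl⟩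
  rw [List.map_id] at hc
  obtain ⟨hp, hcl, -, hs⟩ := Config.placeAll (c := (Config.clean : Config S)) (X := X) hnd
    (vs := ts) (by intro f _ v hv; simp [Config.clean] at hv) fun v hv => ⟨hts v hv, hmem v hv⟩
  rw [← hc] at hp hcl hs
  have hp0 : (Config.clean : Config S).pending X = 0 := by
    have h : (Config.clean : Config S).cleared X = Config.clean := by
      simp [Config.clean, Config.cleared]
    rw [← h, Config.pending_cleared]
  rw [hp0, add_zero] at hp
  have hsearch := triple_search spec hX hs
  rw [hp, Multiset.coe_card, totalSize_coe, List.map_map, List.length_map, hXlen] at hsearch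
  simp only [Function.comp_def] at hsearch
  refine Triple.bind U.card hsearch (by omega) (by omega) (by omega) ?_
  rintro a _ _ ⟨hQ, rfl, rfl⟩
  have hb := spec.built_le _ _ hQ
  rw [totalSize_coe, List.map_map] at hb
  simp only [Function.comp_def] at hb
  rw [hXlen]
  refine Triple.bind (built a) (triple_free _) (by omega) (by omega) (by omega) ?_
  rintro _ _ _ ⟨rfl, rfl⟩
  refine Triple.pure ⟨hQ, ?_, by omega⟩
  rw [hcl]
  simp [Config.clean, Config.cleared]

end Search

/-! ### The recursive transformations -/

section Transform

variable {S R : Type}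

theorem triple_assignLeaf {c : Config S} (f : R → Option R → R) (L : List (ℕ × ℕ)) :
    Triple (assignLeaf f L) c 0 (10 + 10 * L.length) 0 (fun _ c' m => c' = c ∧ m = 0) := by
  refine Triple.bind 0 (triple_spend _) rfl (by omega) (by omega) ?_
  rintro _ c _ ⟨rfl, rfl⟩
  split
  · refine Triple.bind 0 (triple_readLeaf _) rfl (by omega) (by omega) ?_
    rintro _ c _ ⟨rfl, rfl⟩
    refine Triple.bind 0 (triple_readLeaf _) rfl (by omega) (by omega) ?_
    rintro _ c _ ⟨rfl, rfl⟩
    refine Triple.bind 0 (triple_spend _) rfl (by omega) (by omega) ?_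
    rintro _ c _ ⟨rfl, rfl⟩
    exact Triple.conseq 0 (triple_writeLeaf _ _) rfl (by omega) (by omega) fun _ _ _ h => h
  · refine Triple.bind 0 (triple_readLeaf _) rfl (by omega) (by omega) ?_
    rintro _ c _ ⟨rfl, rfl⟩
    refine Triple.bind 0 (triple_spend _) rfl (by omega) (by omega) ?_
    rintro _ c _ ⟨rfl, rfl⟩
    exact Triple.conseq 0 (triple_writeLeaf _ _) rfl (by omega) (by omega) fun _ _ _ h => h
  · exact Triple.pure ⟨rfl, rfl⟩

variable [LinearOrder S]

theorem triple_visitLeaves {leafStep : List (ℕ × ℕ) → Prog S R Unit}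
    (h : ∀ (L : List (ℕ × ℕ)) (c : Config S), Triple (leafStep L) c 0 (10 + 10 * L.length) 0
      (fun _ c' m => c' = c ∧ m = 0)) {ts : List (ℕ × Tree S)} {U : Finset S}
    (hts : ∀ v ∈ ts, v.2.Good) (hU : ∀ x, x ∈ U ↔ ∃ v ∈ ts, x ∈ v.2.lab) :
    Triple (visitLeaves leafStep ts) Config.clean 0
      (200 * (2 ^ U.card + (ts.map fun v => v.2.size).sum))
      (5 * (ts.map fun v => v.2.size).sum + 2)
      (fun _ c' m => c' = Config.clean ∧ m = 0) := by
  refine Triple.conseq 0 (triple_synchronisedSearch (built := fun _ => 0) (Q := fun _ _ => True)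
    ⟨fun c => ?_, fun c e P N a b _ _ _ _ => Triple.pure ⟨trivial, rfl, rfl⟩,
      fun _ _ _ => Nat.zero_le _⟩ hts hU) rfl le_rfl le_rfl ?_
  · exact Triple.conseq 0 (h _ c) rfl le_rfl (by omega) fun _ _ _ h => ⟨trivial, h⟩
  · rintro _ _ _ ⟨-, h⟩
    exact h

theorem triple_assignTree (f : R → Option R → R) {t₀ t₁ t₂ : Tree S} (h₀ : t₀.Good)
    (h₁ : t₁.Good) (h₂ : t₂.Good) (hl₀ : t₀.lab ⊆ t₁.lab) (hl₂ : t₂.lab ⊆ t₁.lab) :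
    Triple (assignTree f t₀ t₁ t₂) Config.clean 0 (1400 * 2 ^ t₁.lab.card)
      (5 * (t₀.size + t₁.size + t₂.size) + 2) (fun _ c' m => c' = Config.clean ∧ m = 0) := by
  have hs₀ := h₀.size_lt
  have hs₁ := h₁.size_lt
  have hs₂ := h₂.size_lt
  have hp₀ : 2 ^ (t₀.lab.card + 1) ≤ 2 ^ (t₁.lab.card + 1) :=
    Nat.pow_le_pow_right (by omega) (by have := Finset.card_le_card hl₀; omega)
  have hp₂ : 2 ^ (t₂.lab.card + 1) ≤ 2 ^ (t₁.lab.card + 1) :=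
    Nat.pow_le_pow_right (by omega) (by have := Finset.card_le_card hl₂; omega)
  rw [pow_succ 2 t₁.lab.card] at *
  refine Triple.conseq 0 (triple_visitLeaves (U := t₁.lab) (fun L _ => triple_assignLeaf f L)
    ?_ ?_) rfl ?_ ?_ fun _ _ _ h => h
  · simp [h₀, h₁, h₂]
  · intro x
    have := @hl₀ x
    have := @hl₂ x
    simp only [List.exists_mem_cons_iff, List.not_mem_nil, false_and, exists_false, or_false]
    tauto
  · simp only [List.map_cons, List.sum_cons, List.map_nil, List.sum_nil]
    omega
  · simp only [List.map_cons, List.sum_cons, List.map_nil, List.sum_nil]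
    omega

/-- The costs of a recursive transformation of a tree with `m` labels: on each level of the
recursion the trees have `O(2 ^ m)` vertices together, and at any time only boundedly many trees
per level are stored. -/
theorem triple_transformAux (ρ : Rule R) {k : ℕ} {t : Tree S} (ht : t.Good)
    (hk : t.lab.card ≤ k) :
    Triple (transformAux ρ k t) Config.clean 0 (3000 * ((t.lab.card + 1) * 2 ^ t.lab.card))
      (40 * ((t.lab.card + 1) * t.size))
      (fun u c' m => u.shape = t.shape ∧ c' = Config.clean ∧ m = t.size + 1) := by
  induction k generalizing t with
  | zero =>
    cases t with
    | leaf a =>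
      exact Triple.conseq 0 (triple_copyTree (Tree.leaf a)) rfl (by simp [Tree.size, Tree.lab])
        (by simp [Tree.size, Tree.lab]) fun _ _ _ h => h
    | node x l r =>
      rw [ht.card_lab_node] at hk
      omega
  | succ k ih =>
    cases t with
    | leaf a =>
      exact Triple.conseq 0 (triple_copyTree (Tree.leaf a)) rfl (by simp [Tree.size, Tree.lab])
        (by simp [Tree.size, Tree.lab]) fun _ _ _ h => h
    | node x l r =>
      rw [ht.card_lab_node] at hk ⊢
      obtain ⟨hx, hrl, hl, hr⟩ := id ht
      have hsl := hl.size_lt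
      have hst := ht.size_lt
      rw [ht.card_lab_node] at hst
      have hs : (Tree.node x l r).size = l.size + r.size + 1 := rfl
      have hl1 := l.one_le_size
      set n := l.lab.card with hn
      set σ := (Tree.node x l r).size with hσ
      have hpn : 2 ^ l.lab.card = 2 ^ n := rfl
      -- the work outside of the two recursive calls costs at most `6000 * 2 ^ n`, where `n + 1` is
      -- the number of labels, and takes at most `40 * σ` cells, where `σ` is the number of vertices
      have e₁ : (n + 1 + 1) * 2 ^ (n + 1) = 2 * ((n + 1) * 2 ^ n) + 2 * 2 ^ n := by ring
      have e₂ : (n + 1 + 1) * σ = (n + 1) * σ + σ := by ring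
      have e₃ : (n + 1) * l.size ≤ (n + 1) * σ := Nat.mul_le_mul_left _ (by omega)
      rw [e₁, e₂]
      simp only [pow_succ] at hsl hst
      refine Triple.call (τ₁ := 3000 * (2 * ((n + 1) * 2 ^ n) + 2 * 2 ^ n) - 2)
        (π₁ := 40 * ((n + 1) * σ + σ) - 1) ?_ (by omega) (by omega) (by omega)
      refine Triple.bind 0 (triple_copyTree l) rfl (by omega) (by omega) ?_
      rintro u _ _ ⟨hu, rfl, rfl⟩
      have ihu := ih (Tree.good_of_shape_eq hu hl)
        ((Tree.lab_eq_of_shape_eq hu).symm ▸ by omega)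
      refine Triple.bind (l.size + 1) (triple_copyTree l) (by omega) (by omega) (by omega) ?_
      rintro v _ _ ⟨hv, rfl, rfl⟩
      have ihv := ih (Tree.good_of_shape_eq hv hl)
        ((Tree.lab_eq_of_shape_eq hv).symm ▸ by omega)
      have hus := Tree.size_eq_of_shape_eq hu
      have hvs := Tree.size_eq_of_shape_eq hv
      have hul := Tree.lab_eq_of_shape_eq hu
      have hvl := Tree.lab_eq_of_shape_eq hv
      rw [hul, hus, ← hn] at ihu
      rw [hvl, hvs, ← hn] at ihv
      refine Triple.bind (2 * (l.size + 1)) (triple_assignTree _ (Tree.good_of_shape_eq hu hl) hl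
        hr hul.subset hrl) (by omega) (by omega) (by omega) ?_
      rintro _ _ _ ⟨rfl, rfl⟩
      refine Triple.bind (2 * (l.size + 1)) (triple_assignTree _ (Tree.good_of_shape_eq hv hl) hl
        hr hvl.subset hrl) (by omega) (by omega) (by omega) ?_
      rintro _ _ _ ⟨rfl, rfl⟩
      refine Triple.bind (2 * (l.size + 1)) ihu (by omega) (by omega) (by omega) ?_
      rintro u' _ _ ⟨hu', rfl, rfl⟩
      refine Triple.bind (2 * (l.size + 1)) (triple_dispose u) (by omega) (by omega) (by omega) ?_
      rintro _ _ _ ⟨rfl, rfl⟩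
      refine Triple.bind (2 * (l.size + 1)) ihv (by omega) (by omega) (by omega) ?_
      rintro v' _ _ ⟨hv', rfl, rfl⟩
      refine Triple.bind (2 * (l.size + 1)) (triple_dispose v) (by omega) (by omega) (by omega) ?_
      rintro _ _ _ ⟨rfl, rfl⟩
      rw [hu] at hu'
      rw [hv] at hv'
      have hus := Tree.size_eq_of_shape_eq hu'
      have hvs := Tree.size_eq_of_shape_eq hv'
      have hul := Tree.lab_eq_of_shape_eq hu'
      have hvl := Tree.lab_eq_of_shape_eq hv'
      refine Triple.bind (2 * (l.size + 1)) (triple_copyTree (Tree.node x l r)) (by omega)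
        (by omega) (by omega) ?_
      rintro w _ _ ⟨hw, rfl, rfl⟩
      cases w with
      | leaf a => simp [Tree.shape] at hw
      | node y l' r' =>
        have hw' := hw
        simp only [Tree.shape, Tree.node.injEq] at hw'
        obtain ⟨-, hl', hr'⟩ := hw'
        have hsl' := Tree.size_eq_of_shape_eq hl'
        have hsr' := Tree.size_eq_of_shape_eq hr'
        refine Triple.bind (σ + 1 + 2 * (l.size + 1)) (triple_assignTree _
          (Tree.good_of_shape_eq hl' hl) (Tree.good_of_shape_eq hu' hl)
          (Tree.good_of_shape_eq hv' hl)
          ((Tree.lab_eq_of_shape_eq hl').trans hul.symm).subset (hvl.trans hul.symm).subset)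
          (by omega) (by rw [hul]; omega) (by omega) ?_
        rintro _ _ _ ⟨rfl, rfl⟩
        refine Triple.bind (σ + 1 + 2 * (l.size + 1)) (triple_assignTree _
          (Tree.good_of_shape_eq hr' hr) (Tree.good_of_shape_eq hu' hl)
          (Tree.good_of_shape_eq hv' hl)
          (by rwa [Tree.lab_eq_of_shape_eq hr', hul]) (hvl.trans hul.symm).subset)
          (by omega) (by rw [hul]; omega) (by omega) ?_
        rintro _ _ _ ⟨rfl, rfl⟩
        rw [hul]
        refine Triple.bind (σ + 1 + (l.size + 1)) (triple_dispose u') (by omega) (by omega)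
          (by omega) ?_
        rintro _ _ _ ⟨rfl, rfl⟩
        refine Triple.bind (σ + 1) (triple_dispose v') (by omega) (by omega) (by omega) ?_
        rintro _ _ _ ⟨rfl, rfl⟩
        exact Triple.pure ⟨hw, rfl, by omega⟩

theorem triple_transform (ρ : Rule R) {t : Tree S} (ht : t.Good) :
    Triple (transform ρ t) Config.clean 0 (3000 * ((t.lab.card + 1) * 2 ^ t.lab.card))
      (40 * ((t.lab.card + 1) * t.size))
      (fun u c' m => u.shape = t.shape ∧ c' = Config.clean ∧ m = t.size + 1) :=
  triple_transformAux ρ ht ht.spine_eq.ge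

end Transform

/-! ### Products and marginals -/

section Marginals

variable {S R : Type}

theorem triple_multiplyValues [Field R] {c : Config S} (L : List (ℕ × ℕ)) (v : R) :
    Triple (multiplyValues L v) c 0 (2 * L.length + 1) 0 (fun _ c' m => c' = c ∧ m = 0) := by
  induction L generalizing v with
  | nil =>
    refine Triple.bind 0 (triple_spend 1) rfl (by simp) (by simp) ?_
    rintro _ c _ ⟨rfl, rfl⟩
    exact Triple.pure ⟨rfl, rfl⟩
  | cons l L ih =>
    obtain ⟨i, a⟩ := l
    rw [List.length_cons]
    refine Triple.bind 0 (triple_spend 1) rfl (by omega) (by omega) ?_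
    rintro _ c _ ⟨rfl, rfl⟩
    split
    · exact Triple.conseq 0 (ih v) rfl (by omega) (by omega) fun _ _ _ h => h
    · refine Triple.bind 0 (triple_readLeaf a) rfl (by omega) (by omega) ?_
      rintro _ c _ ⟨rfl, rfl⟩
      exact Triple.conseq 0 (ih _) rfl (by omega) (by omega) fun _ _ _ h => h

theorem triple_multiplyLeaf [Field R] {c : Config S} (L : List (ℕ × ℕ)) :
    Triple (R := R) (multiplyLeaf L) c 0 (10 + 10 * L.length) 0
      (fun _ c' m => c' = c ∧ m = 0) := by
  refine Triple.bind 0 (triple_spend _) rfl (by omega) (by omega) ?_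
  rintro _ c _ ⟨rfl, rfl⟩
  split
  · refine Triple.bind 0 (triple_multiplyValues L 1) rfl (by omega) (by omega) ?_
    rintro _ c _ ⟨rfl, rfl⟩
    exact Triple.conseq 0 (triple_writeLeaf _ _) rfl (by omega) (by omega) fun _ _ _ h => h
  · exact Triple.pure ⟨rfl, rfl⟩

theorem triple_spreadLeaf {c : Config S} (L : List (ℕ × ℕ)) :
    Triple (R := R) (spreadLeaf L) c 0 (10 + 10 * L.length) 0
      (fun _ c' m => c' = c ∧ m = 0) := by
  refine Triple.bind 0 (triple_spend _) rfl (by omega) (by omega) ?_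
  rintro _ c _ ⟨rfl, rfl⟩
  split
  · refine Triple.bind 0 (triple_readLeaf _) rfl (by omega) (by omega) ?_
    rintro v c _ ⟨rfl, rfl⟩
    refine Triple.conseq 0 (triple_forEach (ν := fun _ => 0) (τ₁ := fun _ => 1) (B := 0) ?_)
      (by simp) ?_ (by simp) fun _ _ _ h => h
    · intro l _
      split
      · exact triple_spend 1
      · exact triple_writeLeaf _ _
    · simp
      omega
  · exact Triple.pure ⟨rfl, rfl⟩

/-- The shapes of the trees in two lists agree. -/
def SameShapes (us ts : List (Tree S)) : Prop := us.map Tree.shape = ts.map Tree.shape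

theorem sameShapes_of_forall₂ {ts us : List (Tree S)}
    (h : List.Forall₂ (fun t u => u.shape = t.shape) ts us) : SameShapes us ts := by
  induction h with
  | nil => rfl
  | cons h _ ih => exact congrArg₂ List.cons h ih

theorem SameShapes.map_eq {β : Type} {us ts : List (Tree S)} (h : SameShapes us ts)
    {f : Tree S → β} (hf : ∀ t, f t.shape = f t) : us.map f = ts.map f := by
  have := congrArg (List.map f) h
  simpa [List.map_map, Function.comp_def, hf] using this

theorem SameShapes.map_size {us ts : List (Tree S)} (h : SameShapes us ts) :
    us.map Tree.size = ts.map Tree.size :=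
  h.map_eq Tree.size_shape

theorem SameShapes.forall_iff {us ts : List (Tree S)} (h : SameShapes us ts) {p : Tree S → Prop}
    (hp : ∀ t, p t.shape = p t) : (∀ u ∈ us, p u) ↔ ∀ t ∈ ts, p t := by
  have : (∀ q ∈ us.map p, q) ↔ ∀ q ∈ ts.map p, q := by rw [h.map_eq hp]
  rwa [List.forall_mem_map, List.forall_mem_map] at this

theorem SameShapes.exists_iff {us ts : List (Tree S)} (h : SameShapes us ts) {p : Tree S → Prop}
    (hp : ∀ t, p t.shape = p t) : (∃ u ∈ us, p u) ↔ ∃ t ∈ ts, p t := by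
  have : (∃ q ∈ us.map p, q) ↔ ∃ q ∈ ts.map p, q := by rw [h.map_eq hp]
  simpa only [List.mem_map, exists_exists_and_eq_and] using this

theorem triple_disposeAll {c : Config S} (ts : List (Tree S)) :
    Triple (R := R) (forEach dispose ts) c ((ts.map Tree.size).sum + ts.length)
      ((ts.map Tree.size).sum + 2 * ts.length + 1) ((ts.map Tree.size).sum + ts.length)
      (fun _ c' m => c' = c ∧ m = 0) := by
  have hsum : (ts.map fun t => t.size + 1).sum = (ts.map Tree.size).sum + ts.length := by
    rw [List.sum_map_add]
    simp
  refine Triple.conseq 0 (triple_forEach (ν := fun t => t.size + 1) (τ₁ := fun t => t.size + 1)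
    (B := 0) fun t _ => triple_dispose t) ?_ ?_ ?_ fun _ _ _ h => h <;> rw [hsum] <;> omega

theorem others_sum (ts : List (Tree S)) :
    ((others ts).map fun v => v.2.size).sum = (ts.map Tree.size).sum := by
  simp [others, List.map_map, Function.comp_def]

theorem length_le_sum_size (ts : List (Tree S)) : ts.length ≤ (ts.map Tree.size).sum := by
  simpa using card_le_totalSize (ts : Multiset (Tree S))

theorem mem_others {ts : List (Tree S)} {p : Tree S → Prop} :
    (∀ v ∈ others ts, p v.2) ↔ ∀ t ∈ ts, p t := by
  simp [others]

theorem exists_mem_others {ts : List (Tree S)} {p : Tree S → Prop} :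
    (∃ v ∈ others ts, p v.2) ↔ ∃ t ∈ ts, p t := by
  simp [others]

variable [LinearOrder S]

/-- The tree built by a search for a union: there is one if there are trees, and then it is a
straddle-tree with the labels of these trees, and not larger than all of them together. -/
def IsUnion (M : Multiset (Tree S)) (o : Option (Tree S)) : Prop :=
  (o = none ↔ M = 0) ∧ ∀ t ∈ o, t.Good ∧ (∀ y, y ∈ t.lab ↔ ∃ v ∈ M, y ∈ v.lab) ∧
    t.size ≤ totalSize M

theorem isUnion_node {e : S} {P : Multiset (Tree S)} {N : List (ℕ × Tree S)} {a b : Tree S}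
    (hP : ∀ v ∈ P, ∀ y ∈ v.lab, e < y) (hne : N ≠ [])
    (hN : ∀ v ∈ N, (∃ l r, v.2 = Tree.node e l r) ∧ v.2.Good)
    (ha : IsUnion (((N.map fun v => v.2.leftChild : List (Tree S)) : Multiset (Tree S)) + P)
      (some a))
    (hb : IsUnion (N.map fun v => v.2.rightChild : List (Tree S)) (some b)) :
    IsUnion (((N.map Prod.snd : List (Tree S)) : Multiset (Tree S)) + P) (some (.node e a b)) := by
  obtain ⟨-, ha⟩ := ha
  obtain ⟨-, hb⟩ := hb
  obtain ⟨hga, hla, hsa⟩ := ha a rfl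
  obtain ⟨hgb, hlb, hsb⟩ := hb b rfl
  have hsz := sum_size_children fun v hv => (hN v hv).1
  have hlen : 0 < N.length := List.length_pos_iff.2 hne
  simp only [Multiset.mem_add, or_and_right, exists_or, Multiset.mem_coe, List.mem_map] at hla hlb
  rw [totalSize_add, totalSize_coe] at hsa
  rw [totalSize_coe] at hsb
  -- the labels of `b` are labels of right children, hence of left children
  have hba : b.lab ⊆ a.lab := by
    intro y hy
    obtain ⟨_, ⟨v, hv, rfl⟩, hyv⟩ := (hlb y).1 hy
    obtain ⟨⟨l, r, hlr⟩, hg⟩ := hN v hv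
    refine (hla y).2 (Or.inl ⟨_, ⟨v, hv, rfl⟩, ?_⟩)
    rw [hlr] at hyv hg ⊢
    exact hg.2.1 hyv
  refine ⟨⟨fun h => by simp at h, fun h => ?_⟩, ?_⟩
  · have := congrArg Multiset.card h
    rw [Multiset.card_add, Multiset.coe_card, List.length_map, Multiset.card_zero] at this
    omega
  · rintro t ht
    obtain rfl := Option.some.inj ht
    refine ⟨⟨?_, hba, hga, hgb⟩, ?_, ?_⟩
    · intro y hy
      rcases (hla y).1 hy with ⟨_, ⟨v, hv, rfl⟩, hyv⟩ | ⟨v, hv, hyv⟩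
      · obtain ⟨⟨l, r, hlr⟩, hg⟩ := hN v hv
        rw [hlr] at hyv hg
        exact hg.1 y hyv
      · exact hP v hv y hyv
    · intro y
      rw [Tree.lab, Finset.union_eq_left.2 hba, Finset.mem_insert, hla]
      simp only [Multiset.mem_add, or_and_right, exists_or, Multiset.mem_coe, List.mem_map]
      rw [← or_assoc]
      refine or_congr_left ⟨?_, ?_⟩
      · rintro (rfl | ⟨_, ⟨v, hv, rfl⟩, hyv⟩)
        · obtain ⟨v, hv⟩ := List.exists_mem_of_ne_nil N hne
          obtain ⟨⟨l, r, hlr⟩, hg⟩ := hN v hv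
          exact ⟨_, ⟨v, hv, rfl⟩, by simp [hlr, Tree.lab]⟩
        · obtain ⟨⟨l, r, hlr⟩, hg⟩ := hN v hv
          refine ⟨_, ⟨v, hv, rfl⟩, ?_⟩
          rw [hlr] at hyv ⊢
          exact Finset.mem_insert_of_mem (Finset.mem_union_left _ hyv)
      · rintro ⟨_, ⟨v, hv, rfl⟩, hyv⟩
        obtain ⟨⟨l, r, hlr⟩, hg⟩ := hN v hv
        rw [hlr] at hg
        rw [hlr, hg.lab_node, Finset.mem_insert] at hyv
        refine hyv.imp_right fun hyv => ⟨_, ⟨v, hv, rfl⟩, ?_⟩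
        rwa [hlr]
    · rw [totalSize_add, totalSize_coe, hsz, Tree.size]
      omega

theorem searchSpec_union [Field R] :
    SearchSpec (R := R) (S := S) unionLeaf unionNode (fun o => o.elim 0 Tree.size) IsUnion where
  leaf c := by
    refine Triple.bind 0 (triple_spend 1) rfl (by omega) (by omega) ?_
    rintro _ c _ ⟨rfl, rfl⟩
    split
    · rename_i h
      rw [List.isEmpty_iff] at h
      refine Triple.pure ⟨?_, rfl, rfl⟩
      rw [h]
      exact ⟨by simp, by simp⟩
    · rename_i h
      rw [List.isEmpty_iff] at h
      refine Triple.bind 0 (triple_newLeaf 1) rfl (by omega) (by omega) ?_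
      rintro _ c _ ⟨⟨a, rfl⟩, rfl, rfl⟩
      refine Triple.pure ⟨⟨by simpa using h, ?_⟩, rfl, rfl⟩
      rintro t ht
      obtain rfl := Option.some.inj ht
      have hlen : 0 < c.found.length := List.length_pos_iff.2 h
      refine ⟨trivial, ?_, ?_⟩
      · simp [Tree.lab]
      · rw [totalSize_coe, List.map_map]
        simpa [Function.comp_def, Tree.size, Nat.one_le_iff_ne_zero, Nat.pos_iff_ne_zero] using h
  join c e P N a b hP hN ha hb := by
    refine Triple.bind (a.elim 0 Tree.size + b.elim 0 Tree.size) (triple_spend 1) (by omega)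
      (by omega) (by omega) ?_
    rintro _ c _ ⟨rfl, rfl⟩
    by_cases hne : N = []
    · subst hne
      have hb' : b = none := hb.1.2 (by simp)
      subst hb'
      refine Triple.pure ⟨?_, rfl, by simp⟩
      simpa using ha
    · obtain ⟨t, rfl⟩ : ∃ t, a = some t := by
        rw [← Option.ne_none_iff_exists', Ne, ha.1]
        intro h
        have := congrArg Multiset.card h
        rw [Multiset.card_add, Multiset.coe_card, List.length_map, Multiset.card_zero] at this
        exact hne (List.length_eq_zero_iff.1 (by omega))
      obtain ⟨u, rfl⟩ : ∃ u, b = some u := by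
        rw [← Option.ne_none_iff_exists', Ne, hb.1]
        simpa using hne
      have htrue : (!N.isEmpty) = true := by simpa using hne
      rw [htrue]
      simp only [Option.elim_some]
      refine Triple.bind (t.size + u.size) (triple_newNode e t u) (by omega)
        (by omega) (by omega) ?_
      rintro _ _ _ ⟨rfl, rfl, rfl⟩
      refine Triple.pure ⟨isUnion_node hP hne hN ha hb, rfl, ?_⟩
      simp only [Option.elim_some, Tree.size]
      omega
  built_le M a ha := by
    cases a with
    | none => exact Nat.zero_le _
    | some t => exact (ha.2 t rfl).2.2

theorem triple_product [Field R] {ts : List (Tree S)} (hne : ts ≠ []) (hts : ∀ t ∈ ts, t.Good)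
    {U : Finset S} (hU : ∀ x, x ∈ U ↔ ∃ t ∈ ts, x ∈ t.lab) :
    Triple (R := R) (product ts) Config.clean 0
      (400 * 2 ^ U.card + 601 * (ts.map Tree.size).sum) (20 * (ts.map Tree.size).sum)
      (fun t c' m => (t.Good ∧ t.lab = U ∧ t.size ≤ (ts.map Tree.size).sum) ∧
        c' = Config.clean ∧ m = t.size + 1) := by
  have hlen := length_le_sum_size ts
  have hpos : 0 < ts.length := List.length_pos_iff.2 hne
  refine Triple.bind 0 (triple_alloc 1) rfl (by omega) (by omega) ?_
  rintro _ _ _ ⟨rfl, rfl⟩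
  have h := triple_synchronisedSearch (R := R) searchSpec_union (ts := others ts)
    ((mem_others (p := fun t => t.Good)).2 hts) (U := U)
    (fun x => (hU x).trans (exists_mem_others (p := fun t => x ∈ t.lab)).symm)
  rw [others_sum] at h
  refine Triple.bind 1 h (by omega) (by omega) (by omega) ?_
  rintro o _ _ ⟨hQ, rfl, rfl⟩
  have hsnd : (others ts).map Prod.snd = ts := by simp [others, Function.comp_def]
  rw [hsnd] at hQ
  obtain ⟨t, rfl⟩ : ∃ t, o = some t := by
    rw [← Option.ne_none_iff_exists', Ne, hQ.1]
    simpa using hne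
  obtain ⟨hg, hl, hs⟩ := hQ.2 t rfl
  rw [totalSize_coe] at hs
  have hlU : t.lab = U := by
    ext x
    rw [hl, hU]
    rfl
  have h' := triple_visitLeaves (R := R) (fun L _ => triple_multiplyLeaf L)
    (ts := (0, t) :: others ts) (U := U)
    (List.forall_mem_cons.2 ⟨hg, (mem_others (p := fun t => t.Good)).2 hts⟩) (by
      intro x
      rw [List.exists_mem_cons_iff, exists_mem_others (p := fun t => x ∈ t.lab), ← hU, hlU,
        or_self])
  simp only [List.map_cons, List.sum_cons, others_sum] at h'
  simp only [Option.elim_some]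
  refine Triple.bind (t.size + 1) h' (by omega) (by omega) (by omega) ?_
  rintro _ _ _ ⟨rfl, rfl⟩
  exact Triple.pure ⟨⟨hg, hlU, hs⟩, rfl, by omega⟩

theorem triple_marginalise {t : Tree S} (ht : t.Good) {ts : List (Tree S)}
    (hts : ∀ t ∈ ts, t.Good) (hl : ∀ u ∈ ts, u.lab ⊆ t.lab)
    (hs : t.size ≤ (ts.map Tree.size).sum) :
    Triple (R := R) (marginalise t ts) Config.clean 0
      (200 * 2 ^ t.lab.card + 410 * (ts.map Tree.size).sum) (20 * (ts.map Tree.size).sum)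
      (fun us c' m => SameShapes us ts ∧ c' = Config.clean ∧
        m = (ts.map Tree.size).sum + ts.length) := by
  have hlen := length_le_sum_size ts
  have ht1 := t.one_le_size
  have hsum : (ts.map fun t => t.size + 1).sum = (ts.map Tree.size).sum + ts.length := by
    rw [List.sum_map_add]
    simp
  have hcopy := triple_mapEach (R := R) (c := (Config.clean : Config S)) (f := copyTree) (l := ts)
    (g := fun t => t.size + 1) (τ₁ := fun t => 5 * t.size) (B := 3 * (ts.map Tree.size).sum)
    (r := fun t u => u.shape = t.shape) (fun t ht => by
      have := List.le_sum_of_mem (List.mem_map_of_mem (f := Tree.size) ht)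
      exact Triple.conseq 0 (triple_copyTree t) rfl le_rfl (by omega) fun _ _ _ h => h)
  rw [hsum, List.sum_map_mul_left] at hcopy
  refine Triple.bind 0 hcopy rfl (by omega) (by omega) ?_
  rintro us _ _ ⟨hus, rfl, rfl⟩
  have hus := sameShapes_of_forall₂ hus
  have h' := triple_visitLeaves (R := R) (fun L _ => triple_spreadLeaf L)
    (ts := (0, t) :: others us) (U := t.lab)
    (List.forall_mem_cons.2 ⟨ht, (mem_others (p := fun t => t.Good)).2
      ((hus.forall_iff fun t => propext t.good_shape).2 hts)⟩) (by
      intro x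
      rw [List.exists_mem_cons_iff, exists_mem_others (p := fun t => x ∈ t.lab),
        hus.exists_iff fun t => by rw [Tree.lab_shape]]
      exact ⟨Or.inl, fun h => h.elim id fun ⟨u, hu, hx⟩ => hl u hu hx⟩)
  simp only [List.map_cons, List.sum_cons, others_sum, hus.map_size] at h'
  refine Triple.bind ((ts.map Tree.size).sum + ts.length) h' (by omega) (by omega) (by omega) ?_
  rintro _ _ _ ⟨rfl, rfl⟩
  exact Triple.pure ⟨hus, rfl, by omega⟩

theorem succ_mul_two_pow_le (n : ℕ) : (n + 1) * 2 ^ n ≤ 2 * weight n := by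
  have h : (n + 1) ≤ 2 * max 1 n := by omega
  calc (n + 1) * 2 ^ n ≤ 2 * max 1 n * 2 ^ n := Nat.mul_le_mul_right _ h
    _ = 2 * weight n := by rw [weight, mul_assoc]

theorem two_pow_le_weight (n : ℕ) : 2 ^ n ≤ weight n :=
  Nat.le_mul_of_pos_left _ (by omega)

theorem one_le_weight (n : ℕ) : 1 ≤ weight n := Nat.one_le_two_pow.trans (two_pow_le_weight n)

theorem Tree.Good.size_le_weight {t : Tree S} (ht : t.Good) : t.size ≤ 2 * weight t.lab.card := by
  have h₁ := ht.size_lt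
  have h₂ := two_pow_le_weight t.lab.card
  rw [pow_succ] at h₁
  omega

theorem triple_transformAll (ρ : Rule R) {ts : List (Tree S)} (hts : ∀ t ∈ ts, t.Good)
    {U : Finset S} (hU : ∀ t ∈ ts, t.lab ⊆ U) :
    Triple (mapEach (transform ρ) ts) Config.clean 0
      (6000 * (ts.map fun t => weight t.lab.card).sum + ts.length + 1)
      (42 * ((U.card + 1) * (ts.map Tree.size).sum))
      (fun us c' m => SameShapes us ts ∧ c' = Config.clean ∧
        m = (ts.map Tree.size).sum + ts.length) := by
  have hsum : (ts.map fun t => t.size + 1).sum = (ts.map Tree.size).sum + ts.length := by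
    rw [List.sum_map_add]
    simp
  have hlen := length_le_sum_size ts
  have hmul : (ts.map Tree.size).sum ≤ (U.card + 1) * (ts.map Tree.size).sum :=
    Nat.le_mul_of_pos_left _ (by omega)
  have h := triple_mapEach (R := R) (c := (Config.clean : Config S)) (f := transform ρ) (l := ts)
    (g := fun t => t.size + 1) (τ₁ := fun t => 6000 * weight t.lab.card)
    (B := 40 * ((U.card + 1) * (ts.map Tree.size).sum))
    (r := fun t u => u.shape = t.shape) (fun t ht => by
      refine Triple.conseq 0 (triple_transform ρ (hts t ht)) rfl ?_ ?_ fun _ _ _ h => h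
      · have := succ_mul_two_pow_le t.lab.card
        omega
      · have h₁ := List.le_sum_of_mem (List.mem_map_of_mem (f := Tree.size) ht)
        have h₂ := Finset.card_le_card (hU t ht)
        have := Nat.mul_le_mul (Nat.succ_le_succ h₂) h₁
        simp only [Nat.succ_eq_add_one] at this
        omega)
  rw [hsum, List.sum_map_mul_left] at h
  refine Triple.conseq 0 h rfl le_rfl (by omega) ?_
  rintro us _ _ ⟨hus, rfl, rfl⟩
  exact ⟨sameShapes_of_forall₂ hus, rfl, rfl⟩

/-- The costs of the simultaneous marginalisation, where `U` is the union of the underlying sets of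
the given potentials. -/
theorem triple_marginals [Field R] {ts : List (Tree S)} (hne : ts ≠ []) (hts : ∀ t ∈ ts, t.Good)
    {U : Finset S} (hU : ∀ x, x ∈ U ↔ ∃ t ∈ ts, x ∈ t.lab) :
    Triple (R := R) (marginals ts) Config.clean 0
      (20000 * (weight U.card + (ts.map fun t => weight t.lab.card).sum))
      (100 * ((U.card + 1) * (ts.map Tree.size).sum))
      (fun us c' m => SameShapes us ts ∧ c' = Config.clean ∧
        m = (ts.map Tree.size).sum + ts.length) := by
  have hsub : ∀ t ∈ ts, t.lab ⊆ U := fun t ht x hx => (hU x).2 ⟨t, ht, hx⟩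
  have hlen := length_le_sum_size ts
  have hpos : 0 < ts.length := List.length_pos_iff.2 hne
  have hmul : (ts.map Tree.size).sum ≤ (U.card + 1) * (ts.map Tree.size).sum :=
    Nat.le_mul_of_pos_left _ (by omega)
  have hw : (ts.map Tree.size).sum ≤ 2 * (ts.map fun t => weight t.lab.card).sum := by
    rw [← List.sum_map_mul_left]
    exact List.sum_le_sum fun t ht => (hts t ht).size_le_weight
  have hwU := two_pow_le_weight U.card
  have hwU' := succ_mul_two_pow_le U.card
  set σ := (ts.map Tree.size).sum with hσ
  set W := (ts.map fun t => weight t.lab.card).sum with hW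
  have htr1 := triple_transformAll (rule1 : Rule R) hts hsub
  rw [← hσ, ← hW] at htr1
  refine Triple.bind 0 htr1 rfl (by omega) (by omega) ?_
  rintro ps _ _ ⟨hps, rfl, rfl⟩
  have hpsl : ps.length = ts.length := by simpa using congrArg List.length hps
  have hprod := triple_product (R := R) (ts := ps) (U := U)
    (fun h => by rw [h, List.length_nil] at hpsl; omega)
    ((hps.forall_iff fun t => propext t.good_shape).2 hts)
    (fun x => (hU x).trans (hps.exists_iff fun t => by rw [Tree.lab_shape]).symm)
  have hdisp := triple_disposeAll (R := R) (c := (Config.clean : Config S)) ps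
  rw [hps.map_size, ← hσ] at hprod hdisp
  rw [hpsl] at hdisp
  refine Triple.bind (σ + ts.length) hprod (by omega) (by omega) (by omega) ?_
  rintro g _ _ ⟨⟨hg, hgl, hgs⟩, rfl, rfl⟩
  refine Triple.bind (g.size + 1) hdisp (by omega) (by omega) (by omega) ?_
  rintro _ _ _ ⟨rfl, rfl⟩
  have htr := triple_transform (rule2 : Rule R) hg
  rw [hgl] at htr
  have hgm : (U.card + 1) * g.size ≤ (U.card + 1) * σ := Nat.mul_le_mul_left _ hgs
  refine Triple.bind (g.size + 1) htr (by omega) (by omega) (by omega) ?_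
  rintro h _ _ ⟨hh, rfl, rfl⟩
  refine Triple.bind (g.size + 1) (triple_dispose g) (by omega) (by omega) (by omega) ?_
  rintro _ _ _ ⟨rfl, rfl⟩
  have hhl := (Tree.lab_eq_of_shape_eq hh).trans hgl
  have hhs := Tree.size_eq_of_shape_eq hh
  have hmar := triple_marginalise (R := R) (Tree.good_of_shape_eq hh hg) hts (by rwa [hhl])
    (hhs.trans_le hgs)
  rw [hhl, ← hσ] at hmar
  refine Triple.bind (g.size + 1) hmar (by omega) (by omega) (by omega) ?_
  rintro ms _ _ ⟨hms, rfl, rfl⟩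
  have hmsl : ms.length = ts.length := by simpa using congrArg List.length hms
  refine Triple.bind (σ + ts.length) (triple_dispose h) (by omega) (by omega) (by omega) ?_
  rintro _ _ _ ⟨rfl, rfl⟩
  have htr3 := triple_transformAll (rule3 : Rule R) (ts := ms) (U := U)
    ((hms.forall_iff fun t => propext t.good_shape).2 hts)
    ((hms.forall_iff fun t => by rw [Tree.lab_shape]).2 hsub)
  have hdisp' := triple_disposeAll (R := R) (c := (Config.clean : Config S)) ms
  rw [hms.map_size, hmsl, ← hσ, hms.map_eq fun t => by rw [Tree.lab_shape], ← hW] at htr3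
  rw [hms.map_size, hmsl, ← hσ] at hdisp'
  refine Triple.bind (σ + ts.length) htr3 (by omega) (by omega) (by omega) ?_
  rintro us _ _ ⟨hus, rfl, rfl⟩
  refine Triple.bind (σ + ts.length) hdisp' (by omega) (by omega) (by omega) ?_
  rintro _ _ _ ⟨rfl, rfl⟩
  exact Triple.pure ⟨Eq.trans hus hms, rfl, by omega⟩

end Marginals

/-! ### The steps of the message passing -/

section Steps

variable {S V R F : Type} [LinearOrder S]

theorem weight_mono {m n : ℕ} (h : m ≤ n) : weight m ≤ weight n :=
  Nat.mul_le_mul (max_le_max le_rfl h) (Nat.pow_le_pow_right (by omega) h)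

theorem triple_marginals_of_subset [Field R] {ts : List (Tree S)} (hne : ts ≠ [])
    (hts : ∀ t ∈ ts, t.Good) {D : Finset S} (hD : ∀ t ∈ ts, t.lab ⊆ D) :
    Triple (R := R) (marginals ts) Config.clean 0
      (20000 * (weight D.card + (ts.map fun t => weight t.lab.card).sum))
      (100 * ((D.card + 1) * (ts.map Tree.size).sum))
      (fun us c' m => SameShapes us ts ∧ c' = Config.clean ∧
        m = (ts.map Tree.size).sum + ts.length) := by
  classical
  have hU : ∀ x, x ∈ D.filter (fun x => ∃ t ∈ ts, x ∈ t.lab) ↔ ∃ t ∈ ts, x ∈ t.lab := by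
    intro x
    rw [Finset.mem_filter, and_iff_right_iff_imp]
    rintro ⟨t, ht, hx⟩
    exact hD t ht hx
  have hle := Finset.card_filter_le D (fun x => ∃ t ∈ ts, x ∈ t.lab)
  have hw := weight_mono hle
  have hm := Nat.mul_le_mul_right (ts.map Tree.size).sum (Nat.succ_le_succ hle)
  simp only [Nat.succ_eq_add_one] at hm
  exact Triple.conseq 0 (triple_marginals hne hts hU) rfl (by omega) (by omega)
    fun _ _ _ h => h

theorem sum_size_of_full {l : List F} {f : F → Tree S} {D : F → Finset S}
    (h : ∀ a ∈ l, (f a).Full (D a)) :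
    ((l.map f).map Tree.size).sum + l.length = (l.map fun a => 2 ^ ((D a).card + 1)).sum := by
  induction l with
  | nil => rfl
  | cons a l ih =>
    obtain ⟨ha, hl⟩ := List.forall_mem_cons.1 h
    have := ha.2.2
    have := ih hl
    simp only [List.map_cons, List.sum_cons, List.length_cons]
    omega

theorem sum_weight_of_full {l : List F} {f : F → Tree S} {D : F → Finset S}
    (h : ∀ a ∈ l, (f a).Full (D a)) :
    ((l.map f).map fun t => weight t.lab.card).sum = (l.map fun a => weight (D a).card).sum := by
  rw [List.map_map]
  exact congrArg List.sum (List.map_congr_left fun a ha => by rw [← (h a ha).2.1]; rfl)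

theorem sum_two_pow_le_sum_weight (l : List F) (k : F → ℕ) :
    (l.map fun a => 2 ^ (k a + 1)).sum ≤ 2 * (l.map fun a => weight (k a)).sum := by
  rw [← List.sum_map_mul_left]
  refine List.sum_le_sum fun a _ => ?_
  have := two_pow_le_weight (k a)
  rw [pow_succ]
  omega

variable [DecidableEq V] {bag : V → Finset S} {children : V → List V} {parent : V → Option V}
  {fl : List F} {stored : F → Tree S} {scope : F → Finset S} {C : V} {σ : Store S V} {N W : ℕ}

/-- The costs of an inward step, where `N` is the number of cells that hold the trees involved. -/
theorem triple_inwardStep [Field R]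
    (hmsg : ∀ H ∈ children C, (σ.msg H C).Full (bag H ∩ bag C))
    (hstored : ∀ f ∈ fl, (stored f).Full (scope f)) (hscope : ∀ f ∈ fl, scope f ⊆ bag C)
    (hN : N = ((parent C).toList.map fun P => 2 ^ ((bag C ∩ bag P).card + 1)).sum
      + ((children C).map fun H => 2 ^ ((bag H ∩ bag C).card + 1)).sum
      + (fl.map fun f => 2 ^ ((scope f).card + 1)).sum)
    (hW : W = weight (bag C).card
      + ((children C).map fun H => weight (bag H ∩ bag C).card).sum
      + (fl.map fun f => weight (scope f).card).sum) :
    Triple (R := R) (inwardStep bag children parent (fl.map stored) C σ) Config.clean 0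
      (60000 * W) (200 * (((bag C).card + 1) * N))
      (fun σ' c' m => (σ'.clock = σ.clock ∧
        (∀ P, parent C = some P → (σ'.msg C P).Full (bag C ∩ bag P)) ∧
        ∀ A, A ≠ C → σ'.msg A = σ.msg A) ∧ c' = Config.clean ∧
        m = ((parent C).toList.map fun P => 2 ^ ((bag C ∩ bag P).card + 1)).sum) := by
  have hw1 := one_le_weight (bag C).card
  have hNmul : N ≤ ((bag C).card + 1) * N := Nat.le_mul_of_pos_left _ (by omega)
  unfold inwardStep
  refine Triple.bind 0 (triple_spend 1) rfl (by omega) (by omega) ?_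
  rintro _ _ _ ⟨rfl, rfl⟩
  cases hpar : parent C with
  | none => exact Triple.pure ⟨⟨rfl, by simp, fun _ _ => rfl⟩, rfl, rfl⟩
  | some P =>
    rw [hpar] at hN
    simp only [Option.toList_some, List.map_cons, List.map_nil, List.sum_cons, List.sum_nil,
      add_zero] at hN ⊢
    have hcm := sum_size_of_full hmsg
    have hcf := sum_size_of_full hstored
    have hwm := sum_weight_of_full hmsg
    have hwf := sum_weight_of_full hstored
    have hcm' := sum_two_pow_le_sum_weight (children C) fun H => (bag H ∩ bag C).card
    have hcf' := sum_two_pow_le_sum_weight fl fun f => (scope f).card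
    have hk := two_pow_le_weight (bag C ∩ bag P).card
    have hk' : weight (bag C ∩ bag P).card ≤ weight (bag C).card :=
      weight_mono (Finset.card_le_card Finset.inter_subset_left)
    rw [pow_succ] at hN ⊢
    refine Triple.bind 0 (triple_newTree (bag C ∩ bag P) fun _ => 1) rfl (by omega) (by omega) ?_
    rintro one _ _ ⟨hone, rfl, rfl⟩
    have hsz := hone.2.2
    rw [pow_succ] at hsz ⊢
    set msgs := (children C).map fun H => σ.msg H C with hmsgs
    set fs := fl.map stored with hfs
    have hml : msgs.length = (children C).length := List.length_map _
    have hfl : fs.length = fl.length := List.length_map _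
    have hlen : (one :: (msgs ++ fs)).length = (children C).length + fl.length + 1 := by
      rw [List.length_cons, List.length_append, hml, hfl]
    have hsum : ((one :: (msgs ++ fs)).map Tree.size).sum
        = one.size + ((msgs.map Tree.size).sum + (fs.map Tree.size).sum) := by
      simp
    have hweights : ((one :: (msgs ++ fs)).map fun t => weight t.lab.card).sum
        = weight (bag C ∩ bag P).card + (((children C).map fun H =>
          weight (bag H ∩ bag C).card).sum + (fl.map fun f => weight (scope f).card).sum) := by
      rw [List.map_cons, List.map_append, List.sum_cons, List.sum_append, hone.2.1, hwm, hwf]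
    have hmarg := triple_marginals_of_subset (R := R) (ts := one :: (msgs ++ fs)) (D := bag C)
      (List.cons_ne_nil _ _)
      (by
        simp only [List.mem_cons, List.mem_append, hmsgs, hfs, List.mem_map]
        rintro t (rfl | ⟨H, hH, rfl⟩ | ⟨f, hf, rfl⟩)
        exacts [hone.1, (hmsg H hH).1, (hstored f hf).1])
      (by
        simp only [List.mem_cons, List.mem_append, hmsgs, hfs, List.mem_map]
        rintro t (rfl | ⟨H, hH, rfl⟩ | ⟨f, hf, rfl⟩)
        · exact hone.2.1.trans_subset Finset.inter_subset_left
        · exact (hmsg H hH).2.1.trans_subset Finset.inter_subset_right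
        · exact (hstored f hf).2.1.trans_subset (hscope f hf))
    rw [hsum, hweights, hlen] at hmarg
    have hmul := Nat.mul_le_mul_left ((bag C).card + 1)
      (show one.size + ((msgs.map Tree.size).sum + (fs.map Tree.size).sum) ≤ N by omega)
    simp only [hlen]
    refine Triple.bind (one.size + 1) (triple_alloc _) (by omega) (by omega) (by omega) ?_
    rintro _ _ _ ⟨rfl, rfl⟩
    refine Triple.bind ((children C).length + fl.length + 1 + (one.size + 1)) hmarg (by omega)
      (by omega) (by omega) ?_
    rintro us _ _ ⟨hus, rfl, rfl⟩
    refine Triple.bind (one.size + 1 + (one.size + ((msgs.map Tree.size).sum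
      + (fs.map Tree.size).sum) + ((children C).length + fl.length + 1))) (triple_free _)
      (by omega) (by omega) (by omega) ?_
    rintro _ _ _ ⟨rfl, rfl⟩
    refine Triple.bind (one.size + ((msgs.map Tree.size).sum
      + (fs.map Tree.size).sum) + ((children C).length + fl.length + 1)) (triple_dispose one)
      (by omega) (by omega) (by omega) ?_
    rintro _ _ _ ⟨rfl, rfl⟩
    cases us with
    | nil => simp [SameShapes] at hus
    | cons t rest =>
      obtain ⟨ht, hrest⟩ := List.cons_eq_cons.1 hus
      have hrest : SameShapes rest (msgs ++ fs) := hrest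
      have htfull := Tree.full_of_shape_eq ht hone
      have htsz := Tree.size_eq_of_shape_eq ht
      have hdisp := triple_disposeAll (R := R) (c := (Config.clean : Config S)) rest
      have hrl : rest.length = (children C).length + fl.length := by
        simpa [hml, hfl] using congrArg List.length hrest
      rw [hrest.map_size, List.map_append, List.sum_append, hrl] at hdisp
      refine Triple.bind (one.size + 1) hdisp (by omega) (by omega) (by omega) ?_
      rintro _ _ _ ⟨rfl, rfl⟩
      refine Triple.bind (one.size + 1) (triple_spend 1) (by omega) (by omega) (by omega) ?_
      rintro _ _ _ ⟨rfl, rfl⟩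
      refine Triple.pure ⟨⟨rfl, ?_, ?_⟩, rfl, by omega⟩
      · rintro Q hQ
        obtain rfl := Option.some.inj hQ
        simpa [send] using htfull
      · intro A hA
        simp [send, hA]

/-- The potentials in `ts₁` become messages and stay in the memory, while those in `ts₂` are
superfluous. -/
theorem triple_divideAndSend [Field R] {Es : List V} {ts₁ ts₂ : List (Tree S)} {B : ℕ}
    (hts : List.Forall₂ (fun E t => t.Full (bag E ∩ bag C)) Es ts₁)
    (hmsg : ∀ E ∈ Es, (σ.msg E C).Full (bag E ∩ bag C)) (hne : ∀ E ∈ Es, E ≠ C)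
    (hnd : Es.Nodup) (hB : ∀ E ∈ Es, 20 * 2 ^ ((bag E ∩ bag C).card + 1) ≤ B) :
    Triple (R := R) (divideAndSend C Es (ts₁ ++ ts₂) σ) Config.clean
      ((Es.map fun E => 2 ^ ((bag E ∩ bag C).card + 1)).sum
        + ((ts₂.map Tree.size).sum + ts₂.length))
      (1500 * (Es.map fun E => weight (bag E ∩ bag C).card).sum
        + ((ts₂.map Tree.size).sum + 2 * ts₂.length + 1))
      ((Es.map fun E => 2 ^ ((bag E ∩ bag C).card + 1)).sum
        + ((ts₂.map Tree.size).sum + ts₂.length) + B)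
      (fun σ' c' m => (σ'.clock = σ.clock ∧
        (∀ E ∈ Es, (σ'.msg C E).Full (bag E ∩ bag C)) ∧
        (∀ E, E ∉ Es → σ'.msg C E = σ.msg C E) ∧ ∀ A, A ≠ C → σ'.msg A = σ.msg A) ∧
        c' = Config.clean ∧ m = (Es.map fun E => 2 ^ ((bag E ∩ bag C).card + 1)).sum) := by
  induction hts generalizing σ with
  | nil =>
    simp only [List.map_nil, List.sum_nil, List.nil_append]
    unfold divideAndSend
    refine Triple.bind 0 (triple_disposeAll ts₂) (by omega) (by omega) (by omega) ?_
    rintro _ _ _ ⟨rfl, rfl⟩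
    exact Triple.pure ⟨⟨rfl, by simp, fun _ _ => rfl, fun _ _ => rfl⟩, rfl, rfl⟩
  | @cons E t Es ts₁ ht hts ih =>
    rw [List.forall_mem_cons] at hmsg hne hB
    rw [List.nodup_cons] at hnd
    simp only [List.map_cons, List.sum_cons, List.cons_append]
    unfold divideAndSend
    have h₁ := ht.2.2
    have h₂ := hmsg.1.2.2
    have h₃ := two_pow_le_weight (bag E ∩ bag C).card
    have h₄ := hB.1
    have hassign := triple_assignTree (R := R) (fun a b => b.elim a fun c => a / c) ht.1 ht.1
      hmsg.1.1 subset_rfl (hmsg.1.2.1.trans ht.2.1.symm).subset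
    rw [ht.2.1] at hassign
    set A := (Es.map fun E => 2 ^ ((bag E ∩ bag C).card + 1)).sum
      + ((ts₂.map Tree.size).sum + ts₂.length) with hA
    refine Triple.bind (2 ^ ((bag E ∩ bag C).card + 1) + A) (triple_spend 1) (by omega)
      (by omega) (by omega) ?_
    rintro _ _ _ ⟨rfl, rfl⟩
    refine Triple.bind (2 ^ ((bag E ∩ bag C).card + 1) + A) hassign (by omega)
      (by omega) (by omega) ?_
    rintro _ _ _ ⟨rfl, rfl⟩
    have hsend : ∀ B, B ≠ C → (send C E t σ).msg B = σ.msg B := fun B hB => by simp [send, hB]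
    have ih := ih (σ := send C E t σ) (fun B hB => by
      rw [hsend B (hne.2 B hB)]
      exact hmsg.2 B hB) hne.2 hnd.2 hB.2
    refine Triple.conseq (2 ^ ((bag E ∩ bag C).card + 1)) ih (by omega)
      (by omega) (by omega) ?_
    rintro σ' _ _ ⟨⟨hclock, hfull, hsame, hsame'⟩, rfl, rfl⟩
    refine ⟨⟨hclock, List.forall_mem_cons.2 ⟨?_, hfull⟩, ?_, ?_⟩, rfl, by omega⟩
    · rw [hsame E hnd.1]
      simpa [send] using ht
    · intro B hB
      rw [List.mem_cons, not_or] at hB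
      rw [hsame B hB.2]
      simp [send, hB.1]
    · intro B hB
      rw [hsame' B hB, hsend B hB]

/-- The costs of an outward step, where `N` is the number of cells that hold the trees involved. -/
theorem triple_outwardStep [Field R]
    (hmsg : ∀ H ∈ children C, (σ.msg H C).Full (bag H ∩ bag C))
    (hpar : ∀ P, parent C = some P → (σ.msg P C).Full (bag C ∩ bag P))
    (hne : ∀ H ∈ children C, H ≠ C) (hnd : (children C).Nodup)
    (hstored : ∀ f ∈ fl, (stored f).Full (scope f)) (hscope : ∀ f ∈ fl, scope f ⊆ bag C)
    (hN : N = ((parent C).toList.map fun P => 2 ^ ((bag C ∩ bag P).card + 1)).sum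
      + ((children C).map fun H => 2 ^ ((bag H ∩ bag C).card + 1)).sum
      + (fl.map fun f => 2 ^ ((scope f).card + 1)).sum)
    (hW : W = weight (bag C).card
      + ((children C).map fun H => weight (bag H ∩ bag C).card).sum
      + (fl.map fun f => weight (scope f).card).sum) :
    Triple (R := R) (outwardStep children parent (fl.map stored) C σ) Config.clean 0
      (60000 * W) (200 * (((bag C).card + 1) * N))
      (fun σ' c' m => (σ'.clock = σ.clock ∧
        (∀ H ∈ children C, (σ'.msg C H).Full (bag H ∩ bag C)) ∧
        (∀ H, H ∉ children C → σ'.msg C H = σ.msg C H) ∧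
        ∀ A, A ≠ C → σ'.msg A = σ.msg A) ∧ c' = Config.clean ∧
        m = ((children C).map fun H => 2 ^ ((bag H ∩ bag C).card + 1)).sum) := by
  have hw1 := one_le_weight (bag C).card
  have hNmul : N ≤ ((bag C).card + 1) * N := Nat.le_mul_of_pos_left _ (by omega)
  unfold outwardStep
  refine Triple.bind 0 (triple_spend 1) rfl (by omega) (by omega) ?_
  rintro _ _ _ ⟨rfl, rfl⟩
  split
  · rename_i hem
    rw [List.isEmpty_iff] at hem
    refine Triple.pure ⟨⟨rfl, by simp [hem], fun _ _ => rfl, fun _ _ => rfl⟩, rfl, by simp [hem]⟩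
  · rename_i hem
    rw [List.isEmpty_iff] at hem
    have hpar' : ∀ P ∈ (parent C).toList, (σ.msg P C).Full (bag C ∩ bag P) := fun P hP =>
      hpar P (Option.mem_toList.1 hP)
    have hcm := sum_size_of_full hmsg
    have hcp := sum_size_of_full hpar'
    have hcf := sum_size_of_full hstored
    have hwm := sum_weight_of_full hmsg
    have hwp := sum_weight_of_full hpar'
    have hwf := sum_weight_of_full hstored
    have hcm' := sum_two_pow_le_sum_weight (children C) fun H => (bag H ∩ bag C).card
    have hcp' := sum_two_pow_le_sum_weight (parent C).toList fun P => (bag C ∩ bag P).card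
    have hcf' := sum_two_pow_le_sum_weight fl fun f => (scope f).card
    have hk : ((parent C).toList.map fun P => weight (bag C ∩ bag P).card).sum
        ≤ weight (bag C).card := by
      cases parent C with
      | none => exact Nat.zero_le _
      | some P =>
        simpa using weight_mono (Finset.card_le_card Finset.inter_subset_left)
    set msgs := (children C).map fun H => σ.msg H C with hmsgs
    set pars := (parent C).toList.map fun P => σ.msg P C with hpars
    set fs := fl.map stored with hfs
    have hml : msgs.length = (children C).length := List.length_map _
    have hpl : pars.length = (parent C).toList.length := List.length_map _
    have hfl : fs.length = fl.length := List.length_map _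
    have hlen : (msgs ++ (pars ++ fs)).length
        = (children C).length + ((parent C).toList.length + fl.length) := by
      rw [List.length_append, List.length_append, hml, hpl, hfl]
    have hsum : ((msgs ++ (pars ++ fs)).map Tree.size).sum = (msgs.map Tree.size).sum
        + ((pars.map Tree.size).sum + (fs.map Tree.size).sum) := by
      simp
    have hweights : ((msgs ++ (pars ++ fs)).map fun t => weight t.lab.card).sum
        = ((children C).map fun H => weight (bag H ∩ bag C).card).sum
          + (((parent C).toList.map fun P => weight (bag C ∩ bag P).card).sum
          + (fl.map fun f => weight (scope f).card).sum) := by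
      rw [List.map_append, List.map_append, List.sum_append, List.sum_append, hwm, hwp, hwf]
    have hmarg := triple_marginals_of_subset (R := R) (ts := msgs ++ (pars ++ fs)) (D := bag C)
      (by simp [hmsgs, hem])
      (by
        simp only [List.mem_append, hmsgs, hpars, hfs, List.mem_map]
        rintro t (⟨H, hH, rfl⟩ | ⟨P, hP, rfl⟩ | ⟨f, hf, rfl⟩)
        exacts [(hmsg H hH).1, (hpar' P hP).1, (hstored f hf).1])
      (by
        simp only [List.mem_append, hmsgs, hpars, hfs, List.mem_map]
        rintro t (⟨H, hH, rfl⟩ | ⟨P, hP, rfl⟩ | ⟨f, hf, rfl⟩)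
        · exact (hmsg H hH).2.1.trans_subset Finset.inter_subset_right
        · exact (hpar' P hP).2.1.trans_subset Finset.inter_subset_left
        · exact (hstored f hf).2.1.trans_subset (hscope f hf))
    rw [hsum, hweights, hlen] at hmarg
    set s₁ := (msgs.map Tree.size).sum
    set s₂ := (pars.map Tree.size).sum
    set s₃ := (fs.map Tree.size).sum
    have hmul := Nat.mul_le_mul_left ((bag C).card + 1) (show s₁ + (s₂ + s₃) ≤ N by omega)
    simp only [hlen]
    refine Triple.bind 0 (triple_alloc _) rfl (by omega) (by omega) ?_
    rintro _ _ _ ⟨rfl, rfl⟩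
    refine Triple.bind ((children C).length + ((parent C).toList.length + fl.length)) hmarg
      (by omega) (by omega) (by omega) ?_
    rintro us _ _ ⟨hus, rfl, rfl⟩
    refine Triple.bind (s₁ + (s₂ + s₃) + ((children C).length + ((parent C).toList.length
      + fl.length))) (triple_free _) (by omega) (by omega) (by omega) ?_
    rintro _ _ _ ⟨rfl, rfl⟩
    unfold SameShapes at hus
    rw [List.map_append] at hus
    obtain ⟨ts₁, ts₂, rfl, hts₁, hts₂⟩ := List.map_eq_append_iff.1 hus
    have hts₁ : List.Forall₂ (fun E t => t.Full (bag E ∩ bag C)) (children C) ts₁ := by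
      have h : List.Forall₂ Eq ((children C).map fun H => (σ.msg H C).shape)
          (ts₁.map Tree.shape) := by
        rw [hts₁, hmsgs, List.map_map]
        exact List.forall₂_refl _
      rw [List.forall₂_map_left_iff, List.forall₂_map_right_iff] at h
      refine List.Forall₂.imp ?_ ((List.forall₂_and_left _ _).2 ⟨fun H hH => hH, h⟩)
      rintro H t ⟨hH, ht⟩
      exact Tree.full_of_shape_eq ht.symm (hmsg H hH)
    have hts₂ : SameShapes ts₂ (pars ++ fs) := hts₂
    have htl : ts₂.length = (parent C).toList.length + fl.length := by
      simpa [hpl, hfl] using congrArg List.length hts₂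
    have hdiv := triple_divideAndSend (R := R) (ts₂ := ts₂) (B := 20 * N) hts₁ hmsg hne hnd
      (fun E hE => by
        have := List.le_sum_of_mem (List.mem_map_of_mem
          (f := fun H => 2 ^ ((bag H ∩ bag C).card + 1)) hE)
        omega)
    rw [hts₂.map_size, htl, List.map_append, List.sum_append] at hdiv
    exact Triple.conseq 0 hdiv (by omega) (by omega) (by omega) fun _ _ _ h => h

end Steps

/-! ### The phases of the message passing -/

section Phases

variable {S V R F : Type}

theorem sum_map_eq_sum {l : List F} (hl : l.Nodup) {s : Finset F} (hs : ∀ a, a ∈ l ↔ a ∈ s)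
    (g : F → ℕ) : (l.map g).sum = ∑ a ∈ s, g a := by
  classical
  rw [← List.sum_toFinset g hl]
  exact Finset.sum_congr (Finset.ext fun a => by rw [List.mem_toFinset, hs]) fun _ _ => rfl

theorem sum_map_le_sum {l : List F} (hl : l.Nodup) {s : Finset F} (hs : ∀ a ∈ l, a ∈ s)
    (g : F → ℕ) : (l.map g).sum ≤ ∑ a ∈ s, g a := by
  classical
  rw [← List.sum_toFinset g hl]
  exact Finset.sum_le_sum_of_subset fun a ha => hs a (List.mem_toFinset.1 ha)

theorem triple_loadFactors [LinearOrder S] [DecidableEq F] {scope : F → Finset S}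
    {value : F → Finset S → R} {l : List F} (hl : l.Nodup) {stored : F → Tree S} :
    Triple (loadFactors scope value l stored) Config.clean 0
      (l.map fun f => 10 * 2 ^ (scope f).card).sum (l.map fun f => 8 * 2 ^ (scope f).card).sum
      (fun st c' m => ((∀ f ∈ l, (st f).Full (scope f)) ∧ ∀ f, f ∉ l → st f = stored f) ∧
        c' = Config.clean ∧ m = (l.map fun f => 2 ^ ((scope f).card + 1)).sum) := by
  induction l generalizing stored with
  | nil => exact Triple.pure ⟨⟨by simp, fun _ _ => rfl⟩, rfl, rfl⟩
  | cons f l ih =>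
    rw [List.nodup_cons] at hl
    simp only [List.map_cons, List.sum_cons, pow_succ] at ih ⊢
    refine Triple.bind 0 (triple_newTree (scope f) (value f)) rfl (by omega) (by omega) ?_
    rintro t _ _ ⟨ht, rfl, rfl⟩
    rw [pow_succ]
    refine Triple.conseq (2 ^ (scope f).card * 2) (ih hl.2) (by omega) (by omega) (by omega) ?_
    rintro st _ _ ⟨⟨h₁, h₂⟩, rfl, rfl⟩
    refine ⟨⟨List.forall_mem_cons.2 ⟨?_, h₁⟩, ?_⟩, rfl, by omega⟩
    · rw [h₂ f hl.1, Function.update_self]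
      exact ht
    · intro g hg
      rw [List.mem_cons, not_or] at hg
      rw [h₂ g hg.2, Function.update_of_ne hg.1]

/-- The costs of a phase. `I Cs` is an invariant of the stored messages at the time when the
vertices in `Cs` still have to be treated, and `g C` is the number of cells for the messages that
`C` sends. -/
theorem phase_costs [Fintype V] [DecidableEq V] {step : V → Store S V → Prog S R (Store S V)}
    {I : List V → (V → V → Tree S) → Prop} {τ g : V → ℕ} {B : ℕ}
    (hstep : ∀ C Cs σ, I (C :: Cs) σ.msg → Triple (step C σ) Config.clean 0 (τ C) B
      (fun σ' c' m => (σ'.clock = σ.clock ∧ I Cs σ'.msg) ∧ c' = Config.clean ∧ m = g C))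
    {Cs : List V} (hCs : Cs.Nodup) {σ : Store S V} (hI : I Cs σ.msg) {s : Machine S R}
    (hs : s.config = Config.clean) {r : Store S V × Machine S R}
    (hr : r = (phase step Cs σ).run s) :
    I [] r.1.msg ∧ r.2.config = Config.clean ∧ r.2.live = s.live + (Cs.map g).sum ∧
      r.2.peak ≤ max s.peak (s.live + (Cs.map g).sum + B) ∧
      r.2.time + ∑ C, σ.clock C = s.time + ∑ C, r.1.clock C ∧
      ∀ C, r.1.clock C ≤ σ.clock C + (if C ∈ Cs then τ C + 1 else 0) := by
  induction Cs generalizing σ s with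
  | nil =>
    subst hr
    exact ⟨hI, hs, rfl, le_max_left _ _, rfl, fun C => Nat.le_add_right _ _⟩
  | cons C Cs ih =>
    rw [List.nodup_cons] at hCs
    have htriple : Triple (spend 1 >>= fun _ => step C σ) Config.clean 0 (τ C + 1) B
        (fun σ' c' m => (σ'.clock = σ.clock ∧ I Cs σ'.msg) ∧ c' = Config.clean ∧ m = g C) := by
      refine Triple.bind 0 (triple_spend 1) rfl (by omega) (by omega) ?_
      rintro _ _ _ ⟨rfl, rfl⟩
      exact Triple.conseq 0 (hstep C Cs σ hI) rfl (by omega) le_rfl fun _ _ _ h => h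
    obtain ⟨m, ⟨⟨hclock, hI'⟩, hconf, rfl⟩, hlive, ht, ht', hp⟩ := htriple s s.live hs rfl
    have hrun : (phase step (C :: Cs) σ).run s
        = (phase step Cs { ((spend 1 >>= fun _ => step C σ).run s).1 with
            clock := Function.update ((spend 1 >>= fun _ => step C σ).run s).1.clock C
              (((spend 1 >>= fun _ => step C σ).run s).1.clock C
                + (((spend 1 >>= fun _ => step C σ).run s).2.time - s.time)) }).run
            ((spend 1 >>= fun _ => step C σ).run s).2 := rfl
    rw [hrun] at hr
    generalize (spend 1 >>= fun _ => step C σ).run s = r' at *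
    obtain ⟨h₁, h₂, h₃, h₄, h₅, h₆⟩ := ih hCs.2 (σ := { r'.1 with
      clock := Function.update r'.1.clock C (r'.1.clock C + (r'.2.time - s.time)) }) hI' hconf hr
    simp only [List.map_cons, List.sum_cons]
    refine ⟨h₁, h₂, by omega, by omega, ?_, ?_⟩
    · have hupd : Function.update r'.1.clock C (r'.1.clock C + (r'.2.time - s.time))
          = r'.1.clock + Pi.single C (r'.2.time - s.time) := by
        ext D
        by_cases hD : D = C
        · subst hD; simp
        · simp [hD]
      rw [hupd] at h₅
      simp only [Pi.add_apply, Finset.sum_add_distrib,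
        Finset.sum_pi_single', Finset.mem_univ, if_true, hclock] at h₅
      omega
    · intro D
      have h := h₆ D
      by_cases hD : D = C
      · subst hD
        simp only [Function.update_self, hCs.1, if_false, hclock] at h
        simp only [List.mem_cons, true_or, if_true]
        omega
      · simp only [Function.update_of_ne hD, hclock] at h
        simpa [hD] using h

end Phases

/-! ### The costs of the message passing -/

section Layouts

variable {S V F : Type} {J : JunctionTree S V} {Φ : Factorisation S F} (L : Layout J Φ)

theorem JunctionTree.IsChild.ne {R C H : V} (h : J.IsChild R C H) : H ≠ C := h.1.ne'

theorem Layout.parent_eq_iff_mem_children {C H : V} :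
    L.parent H = some C ↔ H ∈ L.children C := by
  rw [L.parent_eq, L.mem_children]

theorem Layout.mem_children_ne {C H : V} (h : H ∈ L.children C) : H ≠ C :=
  ((L.mem_children C H).1 h).ne

theorem Layout.parent_notMem_children {C P : V} (h : L.parent C = some P) :
    P ∉ L.children C := by
  intro hP
  have h₁ := ((L.parent_eq C P).1 h).2
  have h₂ := ((L.mem_children C P).1 hP).2
  omega

theorem Layout.sum_parent_add_sum_children_le [Fintype V] (C : V) (g : V → ℕ) :
    ((L.parent C).toList.map g).sum + ((L.children C).map g).sum
      ≤ ∑ H ∈ J.neighbours C, g H := by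
  rw [← List.sum_append, ← List.map_append]
  refine sum_map_le_sum ?_ ?_ g
  · refine List.nodup_append.2 ⟨?_, L.children_nodup C, ?_⟩
    · cases L.parent C <;> simp
    · rintro P hP H hH rfl
      exact L.parent_notMem_children (Option.mem_toList.1 hP) hH
  · intro H hH
    simp only [JunctionTree.neighbours, Finset.mem_filter, Finset.mem_univ, true_and]
    rcases List.mem_append.1 hH with hH | hH
    · exact ((L.parent_eq C H).1 (Option.mem_toList.1 hH)).1.symm
    · exact ((L.mem_children C H).1 hH).1

/-- Every vertex is the child of at most one vertex. -/
theorem Layout.sum_sum_children_le [Fintype V] (g : V → ℕ) :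
    ∑ C, ((L.children C).map g).sum ≤ ∑ H, g H := by
  classical
  have h : ∀ C, ((L.children C).map g).sum
      = ∑ H, if L.parent H = some C then g H else 0 := fun C => by
    rw [← Finset.sum_filter]
    exact sum_map_eq_sum (L.children_nodup C) (by simp [L.parent_eq_iff_mem_children]) g
  simp only [h]
  rw [Finset.sum_comm]
  refine Finset.sum_le_sum fun H _ => ?_
  cases L.parent H with
  | none => simp
  | some P => simp

end Layouts

section Costs

variable {S V F : Type} [LinearOrder S] [Fintype V] [DecidableEq V] [Fintype F]
  {J : JunctionTree S V} {Φ : Factorisation S F} (L : Layout J Φ)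

/-- The bound, up to a constant factor, of the computation time at `C`. -/
def Layout.work (C : V) : ℕ :=
  weight (J.bag C).card + ((L.children C).map fun H => weight (J.bag H ∩ J.bag C).card).sum
    + ((L.factors C).map fun f => weight (Φ.scope f).card).sum

/-- The number of cells for the message from `C` to its parent. -/
def Layout.upCells (C : V) : ℕ :=
  ((L.parent C).toList.map fun P => 2 ^ ((J.bag C ∩ J.bag P).card + 1)).sum

/-- The number of cells for the messages from `C` to its children, or from these to `C`. -/
def Layout.downCells (C : V) : ℕ :=
  ((L.children C).map fun H => 2 ^ ((J.bag H ∩ J.bag C).card + 1)).sum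

/-- The number of cells for the factors assigned to `C`. -/
def Layout.factorCells (C : V) : ℕ :=
  ((L.factors C).map fun f => 2 ^ ((Φ.scope f).card + 1)).sum

/-- The bound, up to a constant factor, of the number of cells used temporarily. -/
noncomputable def Layout.workspace : ℕ :=
  Finset.univ.sup fun C : V => max 1 (J.bag C).card *
    (∑ H ∈ J.neighbours C, 2 ^ (J.bag H ∩ J.bag C).card
      + ∑ f with L.home f = C, 2 ^ (Φ.scope f).card)

/-- The cells used temporarily in a step at `C`. The factor 800 is the factor 200 in the costs of a
step, doubled since a straddle-tree with `2 ^ m` leaves occupies `2 ^ (m + 1)` cells, and once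
more to replace `|C| + 1` by `max 1 |C|`. -/
theorem Layout.temporary_le (C : V) :
    200 * (((J.bag C).card + 1) * (L.upCells C + L.downCells C + L.factorCells C))
      ≤ 800 * L.workspace := by
  have h₁ : L.upCells C + L.downCells C
      ≤ 2 * ∑ H ∈ J.neighbours C, 2 ^ (J.bag H ∩ J.bag C).card := by
    have h := L.sum_parent_add_sum_children_le C fun H => 2 ^ ((J.bag H ∩ J.bag C).card + 1)
    simp only [pow_succ, ← Finset.sum_mul] at h
    simp only [Layout.upCells, Layout.downCells, Finset.inter_comm (J.bag C), pow_succ]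
    omega
  have h₂ : L.factorCells C = 2 * ∑ f with L.home f = C, 2 ^ (Φ.scope f).card := by
    rw [Layout.factorCells, sum_map_eq_sum (L.factors_nodup C)
      (s := Finset.univ.filter fun f => L.home f = C) (by simp [L.mem_factors]), Finset.mul_sum]
    exact Finset.sum_congr rfl fun f _ => by rw [pow_succ, mul_comm]
  have h₃ : (J.bag C).card + 1 ≤ 2 * max 1 (J.bag C).card := by omega
  have h₄ : max 1 (J.bag C).card * (∑ H ∈ J.neighbours C, 2 ^ (J.bag H ∩ J.bag C).card
      + ∑ f with L.home f = C, 2 ^ (Φ.scope f).card) ≤ L.workspace :=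
    Finset.le_sup (f := fun C : V => max 1 (J.bag C).card *
      (∑ H ∈ J.neighbours C, 2 ^ (J.bag H ∩ J.bag C).card
        + ∑ f with L.home f = C, 2 ^ (Φ.scope f).card)) (Finset.mem_univ C)
  calc 200 * (((J.bag C).card + 1) * (L.upCells C + L.downCells C + L.factorCells C))
      ≤ 200 * ((2 * max 1 (J.bag C).card)
        * (2 * (∑ H ∈ J.neighbours C, 2 ^ (J.bag H ∩ J.bag C).card
          + ∑ f with L.home f = C, 2 ^ (Φ.scope f).card))) := by
        refine Nat.mul_le_mul_left _ (Nat.mul_le_mul h₃ ?_)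
        omega
    _ = 800 * (max 1 (J.bag C).card * (∑ H ∈ J.neighbours C, 2 ^ (J.bag H ∩ J.bag C).card
          + ∑ f with L.home f = C, 2 ^ (Φ.scope f).card)) := by ring
    _ ≤ 800 * L.workspace := Nat.mul_le_mul_left _ h₄

/-- The invariant of the inward phase: the vertices already treated have sent their messages. -/
def Layout.InwardInv (rem : List V) (msg : V → V → Tree S) : Prop :=
  rem.Pairwise (fun A B => ¬ J.IsChild L.root A B) ∧
    ∀ C, C ∉ rem → ∀ P, L.parent C = some P → (msg C P).Full (J.bag C ∩ J.bag P)

/-- The invariant of the outward phase: all inward messages are there, and the vertices already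
treated have sent their outward messages. -/
def Layout.OutwardInv (rem : List V) (msg : V → V → Tree S) : Prop :=
  rem.Pairwise (fun A B => ¬ J.IsChild L.root B A) ∧
    (∀ C P, L.parent C = some P → (msg C P).Full (J.bag C ∩ J.bag P)) ∧
    ∀ P, P ∉ rem → ∀ C, L.parent C = some P → (msg P C).Full (J.bag C ∩ J.bag P)

theorem Layout.triple_inward {stored : F → Tree S}
    (hstored : ∀ f, (stored f).Full (Φ.scope f)) (C : V) (Cs : List V) (σ : Store S V)
    (hI : L.InwardInv (C :: Cs) σ.msg) :
    Triple (R := ℝ) (inwardStep J.bag L.children L.parent ((L.factors C).map stored) C σ)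
      Config.clean 0 (60000 * L.work C) (800 * L.workspace)
      (fun σ' c' m => (σ'.clock = σ.clock ∧ L.InwardInv Cs σ'.msg) ∧ c' = Config.clean ∧
        m = L.upCells C) := by
  obtain ⟨hord, hmsg⟩ := hI
  rw [List.pairwise_cons] at hord
  refine Triple.conseq 0 (triple_inwardStep (scope := Φ.scope) ?_ (fun f _ => hstored f) ?_ rfl
    rfl) rfl le_rfl (L.temporary_le C) ?_
  -- a child of `C` has been treated before `C`
  · intro H hH
    have hch := (L.mem_children C H).1 hH
    refine hmsg H ?_ C (L.parent_eq_iff_mem_children.2 hH)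
    rw [List.mem_cons, not_or]
    exact ⟨hch.ne, fun h => hord.1 H h hch⟩
  · intro f hf
    rw [← (L.mem_factors C f).1 hf]
    exact L.scope_subset f
  · rintro σ' _ _ ⟨⟨hclock, hnew, hold⟩, rfl, rfl⟩
    refine ⟨⟨hclock, hord.2, fun A hA P hP => ?_⟩, rfl, rfl⟩
    by_cases h : A = C
    · subst h
      exact hnew P hP
    · rw [hold A h]
      exact hmsg A (by simp [h, hA]) P hP

theorem Layout.triple_outward {stored : F → Tree S}
    (hstored : ∀ f, (stored f).Full (Φ.scope f)) (C : V) (Cs : List V) (σ : Store S V)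
    (hI : L.OutwardInv (C :: Cs) σ.msg) :
    Triple (R := ℝ) (outwardStep L.children L.parent ((L.factors C).map stored) C σ)
      Config.clean 0 (60000 * L.work C) (800 * L.workspace)
      (fun σ' c' m => (σ'.clock = σ.clock ∧ L.OutwardInv Cs σ'.msg) ∧ c' = Config.clean ∧
        m = L.downCells C) := by
  obtain ⟨hord, hin, hmsg⟩ := hI
  rw [List.pairwise_cons] at hord
  refine Triple.conseq 0 (triple_outwardStep (bag := J.bag) (scope := Φ.scope) ?_ ?_
    (fun H hH => L.mem_children_ne hH) (L.children_nodup C) (fun f _ => hstored f) ?_ rfl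
    rfl) rfl le_rfl (L.temporary_le C) ?_
  · intro H hH
    exact hin H C (L.parent_eq_iff_mem_children.2 hH)
  -- the parent of `C` has been treated before `C`
  · intro P hP
    have hch := (L.parent_eq C P).1 hP
    refine hmsg P ?_ C hP
    rw [List.mem_cons, not_or]
    exact ⟨hch.ne.symm, fun h => hord.1 P h hch⟩
  · intro f hf
    rw [← (L.mem_factors C f).1 hf]
    exact L.scope_subset f
  · rintro σ' _ _ ⟨⟨hclock, hnew, hsame, hold⟩, rfl, rfl⟩
    refine ⟨⟨hclock, hord.2, fun A P hP => ?_, fun P hP A hA => ?_⟩, rfl, rfl⟩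
    · by_cases h : A = C
      · subst h
        rw [hsame P (L.parent_notMem_children hP)]
        exact hin A P hP
      · rw [hold A h]
        exact hin A P hP
    · by_cases h : P = C
      · subst h
        exact hnew A (L.parent_eq_iff_mem_children.1 hA)
      · rw [hold P h]
        exact hmsg P (by simp [h, hP]) A hA

/-- The costs in terms of the lists in the layout. The vertices send their messages one after the
other, so that the temporary cells only enter once. -/
theorem Layout.arch2_costs [Fintype S] [DecidableEq F] :
    (∀ C, (arch2 J Φ L).1.clock C ≤ 120002 * L.work C) ∧
    (arch2 J Φ L).2.time = ∑ C, (arch2 J Φ L).1.clock C ∧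
    (arch2 J Φ L).2.peak ≤ ∑ f, 2 ^ ((Φ.scope f).card + 1)
      + ∑ C, (L.upCells C + L.downCells C) + 2 * Fintype.card S + 800 * L.workspace := by
  obtain ⟨m, ⟨⟨hfull, -⟩, hconf, rfl⟩, hlive, -⟩ :=
    triple_loadFactors (R := ℝ) (scope := Φ.scope) (value := Φ.value) L.allFactors_nodup
      (stored := fun _ => Tree.leaf 0) (emptyMachine S ℝ) (2 * Fintype.card S) rfl rfl
  rw [sum_map_eq_sum L.allFactors_nodup (s := Finset.univ) (by simp [L.mem_allFactors])] at hlive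
  set input := (loadFactors Φ.scope Φ.value L.allFactors fun _ => Tree.leaf 0).run
    (emptyMachine S ℝ) with hinput
  have hstored : ∀ f, (input.1 f).Full (Φ.scope f) := fun f => hfull f (L.mem_allFactors f)
  obtain ⟨r₁, hr₁⟩ : ∃ r₁, r₁ = (phase (fun C => inwardStep J.bag L.children L.parent
      ((L.factors C).map input.1) C) L.inward ⟨fun _ _ => Tree.leaf 0, fun _ => 0⟩).run
      { input.2 with time := 0, peak := input.2.live } := ⟨_, rfl⟩
  have harch : arch2 J Φ L = (phase (fun C => outwardStep L.children L.parent
      ((L.factors C).map input.1) C) L.outward r₁.1).run r₁.2 := by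
    rw [hr₁]
    rfl
  obtain ⟨hI₁, hc₁, hl₁, hp₁, ht₁, hk₁⟩ := phase_costs (L.triple_inward hstored) L.inward_nodup
    (s := { input.2 with time := 0, peak := input.2.live })
    ⟨L.inward_order, fun C hC => absurd (L.mem_inward C) hC⟩ hconf hr₁
  obtain ⟨-, -, -, hp₂, ht₂, hk₂⟩ := phase_costs (L.triple_outward hstored) L.outward_nodup
    ⟨L.outward_order, fun C => hI₁.2 C List.not_mem_nil,
      fun C hC => absurd (L.mem_outward C) hC⟩ hc₁ harch
  rw [sum_map_eq_sum L.inward_nodup (s := Finset.univ) (by simp [L.mem_inward])] at hl₁ hp₁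
  rw [sum_map_eq_sum L.outward_nodup (s := Finset.univ) (by simp [L.mem_outward])] at hp₂
  simp only [Finset.sum_const_zero, zero_add, add_zero] at ht₁
  refine ⟨fun C => ?_, by omega, ?_⟩
  · have h₁ := hk₁ C
    have h₂ := hk₂ C
    rw [if_pos (L.mem_inward C)] at h₁
    rw [if_pos (L.mem_outward C)] at h₂
    have : 1 ≤ L.work C := (one_le_weight _).trans ((Nat.le_add_right _ _).trans
      (Nat.le_add_right _ _))
    simp only at h₁
    omega
  · rw [Finset.sum_add_distrib]
    simp only at hp₁ hl₁
    omega

theorem Layout.sum_work_le :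
    ∑ C, L.work C ≤ 2 * (∑ C, weight (J.bag C).card + ∑ f, weight (Φ.scope f).card) := by
  have h₁ : ∑ C, ((L.children C).map fun H => weight (J.bag H ∩ J.bag C).card).sum
      ≤ ∑ C, weight (J.bag C).card := by
    refine le_trans (Finset.sum_le_sum fun C _ => ?_)
      (L.sum_sum_children_le fun H => weight (J.bag H).card)
    exact List.sum_le_sum fun H _ => weight_mono (Finset.card_le_card Finset.inter_subset_left)
  have h₂ : ∑ C, ((L.factors C).map fun f => weight (Φ.scope f).card).sum
      = ∑ f, weight (Φ.scope f).card := by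
    rw [← Finset.sum_fiberwise Finset.univ L.home]
    exact Finset.sum_congr rfl fun C _ =>
      sum_map_eq_sum (L.factors_nodup C) (by simp [L.mem_factors]) _
  simp only [Layout.work, Finset.sum_add_distrib]
  omega

end Costs

end ARCH2

theorem mainTheorem8 :
    ∃ K : ℕ, ∀ (S V F : Type) [Fintype S] [LinearOrder S] [Fintype V] [DecidableEq V]
      [Fintype F] [DecidableEq F] (J : ARCH2.JunctionTree S V) (Φ : ARCH2.Factorisation S F)
      (L : ARCH2.Layout J Φ),
      (∀ C : V, (ARCH2.arch2 J Φ L).1.clock C ≤ K * (ARCH2.weight (J.bag C).card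
          + ((L.children C).map fun H => ARCH2.weight (J.bag H ∩ J.bag C).card).sum
          + ∑ f with L.home f = C, ARCH2.weight (Φ.scope f).card)) ∧
      (ARCH2.arch2 J Φ L).2.time = ∑ C, (ARCH2.arch2 J Φ L).1.clock C ∧
      (ARCH2.arch2 J Φ L).2.time ≤ K * (∑ C, ARCH2.weight (J.bag C).card
          + ∑ f, ARCH2.weight (Φ.scope f).card) ∧
      (ARCH2.arch2 J Φ L).2.peak ≤ ∑ f, 2 ^ ((Φ.scope f).card + 1)
          + ∑ C, ∑ H ∈ J.neighbours C, 2 ^ ((J.bag C ∩ J.bag H).card + 1)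
          + 2 * Fintype.card S
          + K * Finset.univ.sup fun C : V => max 1 (J.bag C).card *
              (∑ H ∈ J.neighbours C, 2 ^ (J.bag H ∩ J.bag C).card
                + ∑ f with L.home f = C, 2 ^ (Φ.scope f).card) := by
  refine ⟨300000, ?_⟩
  intro S V F _ _ _ _ _ _ J Φ L
  obtain ⟨hclock, htime, hpeak⟩ := L.arch2_costs
  refine ⟨fun C => ?_, htime, ?_, ?_⟩
  · rw [← ARCH2.sum_map_eq_sum (L.factors_nodup C) (by simp [L.mem_factors])]
    exact (hclock C).trans (Nat.mul_le_mul_right _ (by norm_num))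
  · rw [htime]
    have h := Finset.sum_le_sum fun C (_ : C ∈ Finset.univ) => hclock C
    rw [← Finset.mul_sum] at h
    have := L.sum_work_le
    omega
  · have h : ∑ C, (L.upCells C + L.downCells C)
        ≤ ∑ C, ∑ H ∈ J.neighbours C, 2 ^ ((J.bag C ∩ J.bag H).card + 1) := by
      refine Finset.sum_le_sum fun C _ => ?_
      simp only [ARCH2.Layout.upCells, ARCH2.Layout.downCells, Finset.inter_comm _ (J.bag C)]
      exact L.sum_parent_add_sum_children_le C _
    rw [ARCH2.Layout.workspace] at hpeak
    omega
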